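/- Let $\Delta\ge 2$ be an integer and let $\lambda\in\mathbb{C}$ be such that $|\lambda|<\lambda^*(\Delta):=\frac{(\Delta-1)^{\Delta-1}}{\Delta^{\Delta}}$. For a finite simple graph $G=(V,E)$ let $Z(G)(\lambda)=\sum_{I}\lambda^{|I|}$, the sum ranging over all independent sets $I\subseteq V$, be its independence polynomial. For non-zero complex numbers $q,\xi$, call $\xi$ a multiplicative $\varepsilon$-approximation to $q$ if $e^{-\varepsilon}\le |q|/|\xi|\le e^{\varepsilon}$ and the angle between $\xi$ and $q$, seen as vectors in $\mathbb{C}=\mathbb{R}^2$, is at most $\varepsilon$. Then there exists a deterministic algorithm which, given (the adjacency lists of) a finite simple graph $G=(V,E)$ of maximum degree at most $\Delta$ and a real number $\varepsilon>0$, computes a multiplicative $\varepsilon$-approximation to $Z(G)(\lambda)$ (in particular $Z(G)(\lambda)\neq 0$) in time $(|V|/\varepsilon)^{O(1)}$. Precisely, there is a constant $K$, depending only on $\Delta$ and $\lambda$, such that the running time is at most $K\left(\frac{|V|+1}{\min(\varepsilon,1)}\right)^{K}$. Here an algorithm is a program of a random access machine over the real numbers that has access to $\varepsilon$, $\operatorname{Re}\lambda$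 and $\operatorname{Im}\lambda$, and the running time is its number of steps, each arithmetic operation on or comparison of two real numbers, and each elementary operation on natural numbers (addition, subtraction, comparison, memory access), counting as one step. -/

import Mathlib

/-! ### The independence polynomial and multiplicative approximation -/

open Classical in
/-- The independence polynomial `Z(G) = ∑ X ^ |I|`, summed over the independent sets `I` of `G`. -/
noncomputable def SimpleGraph.independencePolynomial {V : Type*} [Fintype V]
    (G : SimpleGraph V) : Polynomial ℂ :=
  ∑ I ∈ Finset.univ.filter (fun I : Finset V => G.IsIndepSet (I : Set V)),
    Polynomial.X ^ I.card

/-- `ξ` is a multiplicative `ε`-approximation to `q`: both are nonzero,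
`e ^ (-ε) ≤ |q| / |ξ| ≤ e ^ ε`, and the angle between `ξ` and `q`, seen as vectors of the
Euclidean plane, is at most `ε`. -/
def IsMultApprox (ε : ℝ) (q ξ : ℂ) : Prop :=
  q ≠ 0 ∧ ξ ≠ 0 ∧
    Real.exp (-ε) ≤ ‖q‖ / ‖ξ‖ ∧ ‖q‖ / ‖ξ‖ ≤ Real.exp ε ∧
    InnerProductGeometry.angle ξ q ≤ ε

/-- The threshold `λ*(Δ) = (Δ - 1) ^ (Δ - 1) / Δ ^ Δ` (meant for `1 ≤ Δ`). -/
noncomputable def lambdaStar (Δ : ℕ) : ℝ :=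
  ((Δ : ℝ) - 1) ^ (Δ - 1) / (Δ : ℝ) ^ Δ

/-! ### The machine model: a real random access machine

Programs are finite pieces of text whose literals are natural numbers and rational numbers. They
work on natural numbers (used as counters and addresses; addition and truncated subtraction only)
and on real numbers (the four field operations and comparison). There is no rounding or truncation
from the reals to the naturals. Every elementary operation and every test costs one step. -/

namespace RealRAM

/-- The memory: registers and arrays for natural numbers, registers and arrays for real numbers.
Registers and arrays are named by natural numbers that are fixed in the program text; the position
inside an array is computed at run time. -/
structure Store where
  natReg : ℕ → ℕ
  realReg : ℕ → ℝ
  natArr : ℕ → ℕ → ℕ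
  realArr : ℕ → ℕ → ℝ

/-- The elementary operations. The first argument names the target. -/
inductive Instr where
  /-- natural register `d` gets the literal `k` -/
  | natConst (d k : ℕ)
  /-- natural register `d` gets the value of register `a` -/
  | natCopy (d a : ℕ)
  /-- natural register `d` gets the sum of registers `a`, `b` -/
  | natAdd (d a b : ℕ)
  /-- natural register `d` gets the truncated difference of registers `a`, `b` -/
  | natSub (d a b : ℕ)
  /-- natural register `d` gets the entry of natural array `A` at the position held by `i` -/
  | natLoad (d A i : ℕ)
  /-- the entry of natural array `A` at the position held by `i` gets the value of register `a` -/
  | natStore (A i a : ℕ)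
  /-- real register `d` gets the literal `q` -/
  | realConst (d : ℕ) (q : ℚ)
  /-- real register `d` gets the value of real register `a` -/
  | realCopy (d a : ℕ)
  /-- real register `d` gets the value of natural register `a` -/
  | realOfNat (d a : ℕ)
  /-- real register `d` gets the sum of real registers `a`, `b` -/
  | realAdd (d a b : ℕ)
  /-- real register `d` gets the difference of real registers `a`, `b` -/
  | realSub (d a b : ℕ)
  /-- real register `d` gets the product of real registers `a`, `b` -/
  | realMul (d a b : ℕ)
  /-- real register `d` gets the quotient of real registers `a`, `b`; dividing by zero gives zero,
  which a program could also arrange by a test -/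
  | realDiv (d a b : ℕ)
  /-- real register `d` gets the entry of real array `A` at the position held by `i` -/
  | realLoad (d A i : ℕ)
  /-- the entry of real array `A` at the position held by `i` gets the value of real register
  `a` -/
  | realStore (A i a : ℕ)

/-- Writing into a natural register. -/
def Store.setNat (s : Store) (d x : ℕ) : Store :=
  { s with natReg := Function.update s.natReg d x }

/-- Writing into a real register. -/
noncomputable def Store.setReal (s : Store) (d : ℕ) (x : ℝ) : Store :=
  { s with realReg := Function.update s.realReg d x }

/-- Writing into a natural array. -/
def Store.setNatArr (s : Store) (A i x : ℕ) : Store :=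
  { s with natArr := Function.update s.natArr A (Function.update (s.natArr A) i x) }

/-- Writing into a real array. -/
noncomputable def Store.setRealArr (s : Store) (A i : ℕ) (x : ℝ) : Store :=
  { s with realArr := Function.update s.realArr A (Function.update (s.realArr A) i x) }

/-- The effect of an elementary operation. -/
noncomputable def Instr.run (s : Store) : Instr → Store
  | natConst d k => s.setNat d k
  | natCopy d a => s.setNat d (s.natReg a)
  | natAdd d a b => s.setNat d (s.natReg a + s.natReg b)
  | natSub d a b => s.setNat d (s.natReg a - s.natReg b)
  | natLoad d A i => s.setNat d (s.natArr A (s.natReg i))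
  | natStore A i a => s.setNatArr A (s.natReg i) (s.natReg a)
  | realConst d q => s.setReal d q
  | realCopy d a => s.setReal d (s.realReg a)
  | realOfNat d a => s.setReal d (s.natReg a)
  | realAdd d a b => s.setReal d (s.realReg a + s.realReg b)
  | realSub d a b => s.setReal d (s.realReg a - s.realReg b)
  | realMul d a b => s.setReal d (s.realReg a * s.realReg b)
  | realDiv d a b => s.setReal d (s.realReg a / s.realReg b)
  | realLoad d A i => s.setReal d (s.realArr A (s.natReg i))
  | realStore A i a => s.setRealArr A (s.natReg i) (s.realReg a)

/-- The tests: comparison of two natural or of two real registers. -/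
inductive Test where
  | natLt (a b : ℕ)
  | realLt (a b : ℕ)

/-- The truth value of a test. -/
def Test.Holds (s : Store) : Test → Prop
  | natLt a b => s.natReg a < s.natReg b
  | realLt a b => s.realReg a < s.realReg b

/-- Programs. -/
inductive Program where
  | skip
  | instr (i : Instr)
  | seq (p q : Program)
  | ite (c : Test) (p q : Program)
  | while (c : Test) (p : Program)

/-- `Exec p s s' t`: started on the memory `s`, the program `p` halts with memory `s'` after
exactly `t` steps. -/
inductive Exec : Program → Store → Store → ℕ → Prop where
  | skip (s : Store) : Exec .skip s s 0
  | instr (i : Instr) (s : Store) : Exec (.instr i) s (i.run s) 1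
  | seq {p q : Program} {s₁ s₂ s₃ : Store} {t₁ t₂ : ℕ} :
      Exec p s₁ s₂ t₁ → Exec q s₂ s₃ t₂ → Exec (.seq p q) s₁ s₃ (t₁ + t₂)
  | iteTrue {c : Test} {p q : Program} {s s' : Store} {t : ℕ} :
      c.Holds s → Exec p s s' t → Exec (.ite c p q) s s' (t + 1)
  | iteFalse {c : Test} {p q : Program} {s s' : Store} {t : ℕ} :
      ¬ c.Holds s → Exec q s s' t → Exec (.ite c p q) s s' (t + 1)
  | whileFalse {c : Test} {p : Program} {s : Store} :
      ¬ c.Holds s → Exec (.while c p) s s 1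
  | whileTrue {c : Test} {p : Program} {s₁ s₂ s₃ : Store} {t₁ t₂ : ℕ} :
      c.Holds s₁ → Exec p s₁ s₂ t₁ → Exec (.while c p) s₂ s₃ t₂ →
        Exec (.while c p) s₁ s₃ (t₁ + t₂ + 1)

/-- Programs are deterministic: the result and the number of steps are functions of the input. -/
theorem Exec.deterministic {p : Program} {s s' s'' : Store} {t t' : ℕ}
    (h : Exec p s s' t) (h' : Exec p s s'' t') : s' = s'' ∧ t = t' := by
  induction h generalizing s'' t' with
  | skip => cases h'; exact ⟨rfl, rfl⟩
  | instr => cases h'; exact ⟨rfl, rfl⟩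
  | seq _ _ ih₁ ih₂ =>
    cases h' with
    | seq a b =>
      obtain ⟨rfl, rfl⟩ := ih₁ a
      obtain ⟨rfl, rfl⟩ := ih₂ b
      exact ⟨rfl, rfl⟩
  | iteTrue hc _ ih =>
    cases h' with
    | iteTrue _ a => obtain ⟨rfl, rfl⟩ := ih a; exact ⟨rfl, rfl⟩
    | iteFalse hn _ => exact absurd hc hn
  | iteFalse hc _ ih =>
    cases h' with
    | iteTrue hn _ => exact absurd hn hc
    | iteFalse _ a => obtain ⟨rfl, rfl⟩ := ih a; exact ⟨rfl, rfl⟩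
  | whileFalse hc =>
    cases h' with
    | whileFalse _ => exact ⟨rfl, rfl⟩
    | whileTrue hn _ _ => exact absurd hn hc
  | whileTrue hc _ _ ih₁ ih₂ =>
    cases h' with
    | whileFalse hn => exact absurd hc hn
    | whileTrue _ a b =>
      obtain ⟨rfl, rfl⟩ := ih₁ a
      obtain ⟨rfl, rfl⟩ := ih₂ b
      exact ⟨rfl, rfl⟩

/-- `L` is an adjacency list representation of `G`: for every vertex `v` the list `L v` holds
each neighbour of `v` exactly once, in any order. -/
def IsAdjacencyList {n : ℕ} (G : SimpleGraph (Fin n)) (L : Fin n → List (Fin n)) : Prop :=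
  ∀ v, (L v).Nodup ∧ ∀ w, w ∈ L v ↔ G.Adj v w

/-- All adjacency lists one after another, `L 0 ++ L 1 ++ ⋯ ++ L (n - 1)`. -/
def entries {n : ℕ} (L : Fin n → List (Fin n)) : List ℕ :=
  (List.ofFn fun v => (L v).map Fin.val).flatten

/-- The position in `entries L` at which the list of the vertex `v` begins (and at which the list
of the vertex `v - 1` ends), for `v ≤ n`. -/
def startPos {n : ℕ} (L : Fin n → List (Fin n)) (v : ℕ) : ℕ :=
  ∑ u : Fin n with u.val < v, (L u).length

/-- The initial memory. Natural register `0` holds the number of vertices, natural array `0` holds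
at the positions `0, …, n` where the adjacency lists begin and end in natural array `1`, which
holds the concatenated adjacency lists. Real register `0` holds `ε`, and real registers `1` and `2`
hold the real and the imaginary part of `lam`. Everything else is zero. -/
noncomputable def input {n : ℕ} (L : Fin n → List (Fin n)) (ε : ℝ) (lam : ℂ) : Store where
  natReg r := if r = 0 then n else 0
  realReg r := if r = 0 then ε else if r = 1 then lam.re else if r = 2 then lam.im else 0
  natArr A i :=
    if A = 0 then (if i ≤ n then startPos L i else 0)
    else if A = 1 then (entries L).getD i 0
    else 0
  realArr _ _ := 0

/-- The output: the complex number whose real and imaginary parts are in real registers `0`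
and `1`. -/
def output (s : Store) : ℂ := ⟨s.realReg 0, s.realReg 1⟩

end RealRAM

/-! Removing the vertices one after another writes `Z(G)(λ)` as a product of factors `1 + R`, where
the ratio `R` of a vertex satisfies `R = λ / ∏ (1 + R')` over the ratios `R'` of its neighbours,
each taken in the graph without the vertices removed before. If `|λ| ≤ c λ*(Δ)` with `c < 1`,
ratios with at least one removed neighbour have modulus at most `1 / Δ`, and the recursion
contracts by a factor `c` there. Cutting it off at depth `O(log (n / ε))` therefore costs a
relative error of at most `ε`, while the bounded degree keeps the size of the recursion tree
exponential in its depth, that is, polynomial in `n / ε`. A machine evaluates this tree depth first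
with an explicit stack; the set of removed vertices along the stack is stored as a mark on each
vertex that names the frame which removed it, and a version counter per height makes the marks of
closed frames invalid at no cost. -/

/-! ### Products along a list -/

section Removals

variable {V : Type*} [DecidableEq V]

/-- The steps of removing the members of a list one after another when the members of `S` have
already been removed: a pair `(T, w)` for each vertex `w` that is new, where `T` is the set of the
vertices removed before `w`. -/
def removals (S : Finset V) : List V → List (Finset V × V)
  | [] => []
  | w :: l => if w ∈ S then removals S l else (S, w) :: removals (insert w S) l

theorem subset_notMem_mem_of_mem_removals {S : Finset V} {l : List V} {p : Finset V × V}
    (hp : p ∈ removals S l) : S ⊆ p.1 ∧ p.2 ∉ p.1 ∧ p.2 ∈ l := by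
  induction l generalizing S with
  | nil => simp [removals] at hp
  | cons w l ih =>
    by_cases hw : w ∈ S
    · obtain ⟨hS, hmem, hl⟩ := ih (by simpa [removals, hw] using hp)
      exact ⟨hS, hmem, List.mem_cons_of_mem w hl⟩
    · obtain rfl | hp : p = (S, w) ∨ p ∈ removals (insert w S) l := by
        simpa [removals, hw] using hp
      · exact ⟨subset_rfl, hw, List.mem_cons_self⟩
      · obtain ⟨hS, hmem, hl⟩ := ih hp
        exact ⟨(Finset.subset_insert w S).trans hS, hmem, List.mem_cons_of_mem w hl⟩

theorem length_removals (S : Finset V) (l : List V) :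
    (removals S l).length = (l.toFinset \ S).card := by
  induction l generalizing S with
  | nil => simp [removals]
  | cons w l ih =>
    by_cases hw : w ∈ S
    · simp [removals, hw, ih, Finset.insert_sdiff_of_mem]
    · have hsplit : (w :: l).toFinset \ S = insert w (l.toFinset \ insert w S) := by
        ext u
        by_cases hu : u = w <;> simp [hu, hw]
      rw [hsplit, Finset.card_insert_of_notMem (by simp)]
      simp [removals, hw, ih]

/-- The product of the factors `1 + X T w` over the steps `(T, w)` of removing the members of the
list `l` when the members of `S` have already been removed. -/
def prodAlong {R : Type*} [CommSemiring R] (X : Finset V → V → R) (S : Finset V) (l : List V) :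
    R :=
  ((removals S l).map fun p => 1 + X p.1 p.2).prod

section CommSemiring

variable {R : Type*} [CommSemiring R] (X : Finset V → V → R) {S : Finset V} {w : V}

@[simp]
theorem prodAlong_nil (S : Finset V) : prodAlong X S [] = 1 := by
  simp [prodAlong, removals]

theorem prodAlong_cons_of_mem (hw : w ∈ S) (l : List V) :
    prodAlong X S (w :: l) = prodAlong X S l := by
  simp [prodAlong, removals, hw]

theorem prodAlong_cons_of_notMem (hw : w ∉ S) (l : List V) :
    prodAlong X S (w :: l) = (1 + X S w) * prodAlong X (insert w S) l := by
  simp [prodAlong, removals, hw]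

end CommSemiring

/-- One application of the recursion satisfied by the ratios of the hard-core model. -/
def ratioStep {𝕜 : Type*} [Field 𝕜] (lam : 𝕜) (L : V → List V) (X : Finset V → V → 𝕜)
    (S : Finset V) (v : V) : 𝕜 :=
  lam / prodAlong X (insert v S) (L v)

/-- The approximate ratios obtained by unfolding the recursion `d` times and then replacing the
remaining ratios by `lam`. -/
def truncRatio {𝕜 : Type*} [Field 𝕜] (lam : 𝕜) (L : V → List V) : ℕ → Finset V → V → 𝕜
  | 0 => fun _ _ => lam
  | d + 1 => ratioStep lam L (truncRatio lam L d)

end Removals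

section ProductEstimates

variable {ι 𝕜 : Type*} [NormedField 𝕜] {f g : ι → 𝕜} {l : List ι} {r δ : ℝ}

theorem one_sub_le_norm_one_add {x : 𝕜} (hx : ‖x‖ ≤ r) : 1 - r ≤ ‖1 + x‖ := by
  have h := norm_sub_norm_le (1 : 𝕜) (-x)
  rw [norm_one, norm_neg, sub_neg_eq_add] at h
  linarith

theorem one_add_ne_zero_of_norm_le {x : 𝕜} (hr : r < 1) (hx : ‖x‖ ≤ r) : 1 + x ≠ 0 :=
  norm_pos_iff.1 ((sub_pos.2 hr).trans_le (one_sub_le_norm_one_add hx))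

theorem norm_inv_one_add_le {x : 𝕜} (hr : r < 1) (hx : ‖x‖ ≤ r) :
    ‖(1 + x)⁻¹‖ ≤ (1 - r)⁻¹ := by
  rw [norm_inv]
  exact inv_anti₀ (sub_pos.2 hr) (one_sub_le_norm_one_add hx)

theorem norm_inv_prod_one_add_le (hr : r < 1) (hf : ∀ i ∈ l, ‖f i‖ ≤ r) :
    ‖((l.map fun i => 1 + f i).prod)⁻¹‖ ≤ (1 - r)⁻¹ ^ l.length := by
  have hpos := inv_pos.2 (sub_pos.2 hr)
  induction l with
  | nil => simp
  | cons i l ih =>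
    obtain ⟨hi, hl⟩ := List.forall_mem_cons.1 hf
    rw [List.map_cons, List.prod_cons, mul_inv, norm_mul, List.length_cons, pow_succ']
    exact mul_le_mul (norm_inv_one_add_le hr hi) (ih hl) (norm_nonneg _) hpos.le

theorem norm_inv_prod_one_add_sub_le (hr : r < 1) (hf : ∀ i ∈ l, ‖f i‖ ≤ r)
    (hg : ∀ i ∈ l, ‖g i‖ ≤ r) (hfg : ∀ i ∈ l, ‖f i - g i‖ ≤ δ) :
    ‖((l.map fun i => 1 + f i).prod)⁻¹ - ((l.map fun i => 1 + g i).prod)⁻¹‖ ≤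
      l.length * (1 - r)⁻¹ ^ (l.length + 1) * δ := by
  set A := (1 - r)⁻¹
  have : 0 ≤ A := (inv_pos.2 (sub_pos.2 hr)).le
  induction l with
  | nil => simp
  | cons i l ih =>
    obtain ⟨hfi, hfl⟩ := List.forall_mem_cons.1 hf
    obtain ⟨hgi, hgl⟩ := List.forall_mem_cons.1 hg
    obtain ⟨hi, hl⟩ := List.forall_mem_cons.1 hfg
    set p := (l.map fun i => 1 + f i).prod
    set q := (l.map fun i => 1 + g i).prod
    have hhead : ‖(1 + f i)⁻¹ - (1 + g i)⁻¹‖ ≤ A ^ 2 * δ := by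
      have heq : (1 + f i)⁻¹ - (1 + g i)⁻¹ = (1 + f i)⁻¹ * (1 + g i)⁻¹ * -(f i - g i) := by
        have hf0 := one_add_ne_zero_of_norm_le hr hfi
        have hg0 := one_add_ne_zero_of_norm_le hr hgi
        field_simp
        ring
      rw [heq, norm_mul, norm_mul, norm_neg, sq]
      gcongr
      exacts [norm_inv_one_add_le hr hfi, norm_inv_one_add_le hr hgi]
    have hsplit : ((1 + f i) * p)⁻¹ - ((1 + g i) * q)⁻¹ =
        ((1 + f i)⁻¹ - (1 + g i)⁻¹) * p⁻¹ + (1 + g i)⁻¹ * (p⁻¹ - q⁻¹) := by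
      rw [mul_inv, mul_inv]
      ring
    simp only [List.map_cons, List.prod_cons, List.length_cons]
    calc ‖((1 + f i) * p)⁻¹ - ((1 + g i) * q)⁻¹‖
        ≤ ‖(1 + f i)⁻¹ - (1 + g i)⁻¹‖ * ‖p⁻¹‖ + ‖(1 + g i)⁻¹‖ * ‖p⁻¹ - q⁻¹‖ := by
          rw [hsplit, ← norm_mul, ← norm_mul]
          exact norm_add_le _ _
      _ ≤ A ^ 2 * δ * A ^ l.length + A * (l.length * A ^ (l.length + 1) * δ) := by
          gcongr
          exacts [(norm_nonneg _).trans hhead, norm_inv_prod_one_add_le hr hfl,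
            norm_inv_one_add_le hr hgi, ih hfl hgl hl]
      _ = ((l.length + 1 : ℕ) : ℝ) * A ^ (l.length + 1 + 1) * δ := by
          push_cast
          ring

theorem exists_prod_one_add_eq_mul_exp {f g : ι → ℂ} (hr : r < 1) (hg : ∀ i ∈ l, ‖g i‖ ≤ r)
    (hfg : ∀ i ∈ l, ‖f i - g i‖ ≤ δ) (hδ : δ / (1 - r) ≤ 1 / 2) :
    ∃ z : ℂ, (l.map fun i => 1 + f i).prod = (l.map fun i => 1 + g i).prod * Complex.exp z ∧
      ‖z‖ ≤ l.length * (3 / 2 * (δ / (1 - r))) := by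
  induction l with
  | nil => exact ⟨0, by simp⟩
  | cons i l ih =>
    obtain ⟨hgi, hgl⟩ := List.forall_mem_cons.1 hg
    obtain ⟨hi, hl⟩ := List.forall_mem_cons.1 hfg
    obtain ⟨z, hz, hznorm⟩ := ih hgl hl
    have hg0 := one_add_ne_zero_of_norm_le hr hgi
    set w := (f i - g i) / (1 + g i)
    have hw : ‖w‖ ≤ δ / (1 - r) := by
      rw [norm_div]
      exact div_le_div₀ ((norm_nonneg _).trans hi) hi (sub_pos.2 hr) (one_sub_le_norm_one_add hgi)
    have hfactor : 1 + f i = (1 + g i) * (1 + w) := by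
      simp only [w]
      field_simp
      ring
    have hexp : Complex.exp (Complex.log (1 + w)) = 1 + w :=
      Complex.exp_log (one_add_ne_zero_of_norm_le (by norm_num) (hw.trans hδ))
    refine ⟨Complex.log (1 + w) + z, ?_, ?_⟩
    · simp only [List.map_cons, List.prod_cons]
      rw [hz, Complex.exp_add, hexp, hfactor]
      ring
    · have hlog := Complex.norm_log_one_add_half_le_self (hw.trans hδ)
      calc ‖Complex.log (1 + w) + z‖
          ≤ 3 / 2 * (δ / (1 - r)) + l.length * (3 / 2 * (δ / (1 - r))) :=
            (norm_add_le _ _).trans (by gcongr; exact hlog.trans (by gcongr))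
        _ = ((i :: l).length : ℝ) * (3 / 2 * (δ / (1 - r))) := by
            rw [List.length_cons]
            push_cast
            ring

end ProductEstimates

/-! ### The hard-core model -/

section HardCore

variable {V : Type*} [Fintype V] (G : SimpleGraph V)

open Classical in
/-- The value at `lam` of the independence polynomial of `G` with the vertices in `S` removed. -/
noncomputable def hardcoreSum {R : Type*} [CommSemiring R] (lam : R) (S : Finset V) : R :=
  ∑ I ∈ Finset.univ.filter (fun I : Finset V => G.IsIndepSet (I : Set V) ∧ Disjoint I S),
    lam ^ I.card

theorem hardcoreSum_empty (lam : ℂ) :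
    hardcoreSum G lam ∅ = G.independencePolynomial.eval lam := by
  rw [hardcoreSum, SimpleGraph.independencePolynomial, Polynomial.eval_finsetSum]
  exact Finset.sum_congr (by ext; simp) fun _ _ => by simp

theorem hardcoreSum_univ {R : Type*} [CommSemiring R] (lam : R) :
    hardcoreSum G lam Finset.univ = 1 := by
  classical
  have hfilter : ({I : Finset V | G.IsIndepSet (I : Set V) ∧ Disjoint I Finset.univ} :
      Finset (Finset V)) = {∅} := by
    ext I
    simp only [Finset.mem_filter_univ, Finset.mem_singleton]
    constructor
    · rintro ⟨-, hI⟩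
      exact Finset.disjoint_self_iff_empty I |>.1 (hI.mono_right (Finset.subset_univ I))
    · rintro rfl
      simp [SimpleGraph.isIndepSet_iff]
  simp [hardcoreSum, hfilter]

variable [DecidableEq V] [DecidableRel G.Adj]

theorem isIndepSet_insert_and_disjoint_iff {S I : Finset V} {v : V} (hvS : v ∉ S) (hvI : v ∉ I) :
    G.IsIndepSet (insert v I : Finset V) ∧ Disjoint (insert v I) S ↔
      G.IsIndepSet (I : Set V) ∧ Disjoint I (insert v S ∪ G.neighborFinset v) := by
  have hindep : G.IsIndepSet (insert v I : Finset V) ↔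
      G.IsIndepSet (I : Set V) ∧ Disjoint I (G.neighborFinset v) := by
    rw [SimpleGraph.isIndepSet_iff, SimpleGraph.isIndepSet_iff, Finset.coe_insert,
      Set.pairwise_insert, Finset.disjoint_left]
    refine and_congr_right' (forall₂_congr fun w hw => ?_)
    have hne : v ≠ w := fun h => hvI (h ▸ hw)
    simp [hne, G.adj_comm w v]
  rw [hindep, Finset.disjoint_insert_left, Finset.disjoint_union_right,
    Finset.disjoint_insert_right]
  tauto

theorem hardcoreSum_eq_add {R : Type*} [CommSemiring R] (lam : R) {S : Finset V} {v : V}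
    (hv : v ∉ S) :
    hardcoreSum G lam S = hardcoreSum G lam (insert v S) +
      lam * hardcoreSum G lam (insert v S ∪ G.neighborFinset v) := by
  classical
  unfold hardcoreSum
  rw [← Finset.sum_filter_not_add_sum_filter _ (v ∈ ·), Finset.mul_sum]
  congr 1
  · refine Finset.sum_congr ?_ fun _ _ => rfl
    ext I
    simp only [Finset.mem_filter, Finset.mem_univ, true_and, Finset.disjoint_insert_right]
    tauto
  · refine Finset.sum_bij' (fun I _ => I.erase v) (fun I _ => insert v I) ?_ ?_ ?_ ?_ ?_ <;>
      simp only [Finset.mem_filter, Finset.mem_univ, true_and]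
    · rintro I ⟨hI, hvI⟩
      rw [← isIndepSet_insert_and_disjoint_iff G hv (Finset.notMem_erase v I),
        Finset.insert_erase hvI]
      exact hI
    · intro I hI
      have hvI : v ∉ I := Finset.disjoint_right.1 hI.2 (by simp)
      exact ⟨(isIndepSet_insert_and_disjoint_iff G hv hvI).2 hI, Finset.mem_insert_self v I⟩
    · exact fun I hI => Finset.insert_erase hI.2
    · exact fun I hI => Finset.erase_insert (Finset.disjoint_right.1 hI.2 (by simp))
    · intro I hI
      rw [← pow_succ', Finset.card_erase_add_one hI.2]

variable {𝕜 : Type*}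

/-- The ratio of the contributions of the independent sets with and without `v`, in the graph `G`
with the vertices in `S` removed. -/
noncomputable def hardcoreRatio [Field 𝕜] (lam : 𝕜) (S : Finset V) (v : V) : 𝕜 :=
  lam * hardcoreSum G lam (insert v S ∪ G.neighborFinset v) / hardcoreSum G lam (insert v S)

theorem hardcoreSum_eq_one_add_mul [Field 𝕜] {lam : 𝕜} {S : Finset V} {v : V} (hv : v ∉ S)
    (h0 : hardcoreSum G lam (insert v S) ≠ 0) :
    hardcoreSum G lam S = (1 + hardcoreRatio G lam S v) * hardcoreSum G lam (insert v S) := by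
  rw [hardcoreSum_eq_add G lam hv, hardcoreRatio]
  field_simp

theorem hardcoreSum_eq_prodAlong [Field 𝕜] {lam : 𝕜} {S : Finset V} {l : List V}
    (h0 : ∀ p ∈ removals S l, hardcoreSum G lam (insert p.2 p.1) ≠ 0) :
    hardcoreSum G lam S =
      prodAlong (hardcoreRatio G lam) S l * hardcoreSum G lam (S ∪ l.toFinset) := by
  induction l generalizing S with
  | nil => simp
  | cons w l ih =>
    by_cases hw : w ∈ S
    · have htail := ih fun p hp => h0 p (by simpa [removals, hw] using hp)
      rw [prodAlong_cons_of_mem _ hw, htail, List.toFinset_cons, Finset.union_insert,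
        Finset.insert_eq_of_mem (Finset.mem_union_left _ hw)]
    · have hhead := h0 (S, w) (by simp [removals, hw])
      have htail := ih (S := insert w S) fun p hp => h0 p (by simp [removals, hw, hp])
      rw [prodAlong_cons_of_notMem _ hw, hardcoreSum_eq_one_add_mul G hw hhead, htail,
        List.toFinset_cons, Finset.union_insert, Finset.insert_union, mul_assoc]

theorem hardcoreRatio_eq_ratioStep [Field 𝕜] {lam : 𝕜} {L : V → List V} {S : Finset V} {v : V}
    (hL : (L v).toFinset = G.neighborFinset v)
    (h0 : ∀ T, insert v S ⊆ T → hardcoreSum G lam T ≠ 0) :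
    hardcoreRatio G lam S v = ratioStep lam L (hardcoreRatio G lam) S v := by
  have htele : hardcoreSum G lam (insert v S) = _ * hardcoreSum G lam (_ ∪ (L v).toFinset) :=
    hardcoreSum_eq_prodAlong G fun p hp =>
      h0 _ ((subset_notMem_mem_of_mem_removals hp).1.trans (Finset.subset_insert _ _))
  have hne := h0 (insert v S ∪ (L v).toFinset) Finset.subset_union_left
  rw [hardcoreRatio, ratioStep, htele, ← hL]
  exact mul_div_mul_right _ _ hne

end HardCore

/-! ### Contraction of the recursion below the threshold -/

section RatioStep

variable {V 𝕜 : Type*} [DecidableEq V] [NormedField 𝕜] {lam : 𝕜} {L : V → List V}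
  {X Y : Finset V → V → 𝕜} {S : Finset V} {v : V} {r δ : ℝ} {m : ℕ}

theorem norm_ratioStep_le (hr₀ : 0 ≤ r) (hr : r < 1)
    (hm : (removals (insert v S) (L v)).length ≤ m)
    (hX : ∀ p ∈ removals (insert v S) (L v), ‖X p.1 p.2‖ ≤ r) :
    ‖ratioStep lam L X S v‖ ≤ ‖lam‖ * (1 - r)⁻¹ ^ m := by
  have hA : 1 ≤ (1 - r)⁻¹ := (one_le_inv₀ (sub_pos.2 hr)).2 (by linarith)
  rw [ratioStep, div_eq_mul_inv, norm_mul]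
  gcongr
  exact (norm_inv_prod_one_add_le hr hX).trans (pow_le_pow_right₀ hA hm)

theorem norm_ratioStep_sub_le (hr₀ : 0 ≤ r) (hr : r < 1) (hδ : 0 ≤ δ)
    (hm : (removals (insert v S) (L v)).length ≤ m)
    (hX : ∀ p ∈ removals (insert v S) (L v), ‖X p.1 p.2‖ ≤ r)
    (hY : ∀ p ∈ removals (insert v S) (L v), ‖Y p.1 p.2‖ ≤ r)
    (hXY : ∀ p ∈ removals (insert v S) (L v), ‖X p.1 p.2 - Y p.1 p.2‖ ≤ δ) :
    ‖ratioStep lam L X S v - ratioStep lam L Y S v‖ ≤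
      ‖lam‖ * (m * (1 - r)⁻¹ ^ (m + 1) * δ) := by
  have hA : 1 ≤ (1 - r)⁻¹ := (one_le_inv₀ (sub_pos.2 hr)).2 (by linarith)
  rw [ratioStep, ratioStep, div_eq_mul_inv, div_eq_mul_inv, ← mul_sub, norm_mul]
  gcongr
  exact (norm_inv_prod_one_add_sub_le hr hX hY hXY).trans (by gcongr)

end RatioStep

section Threshold

variable {Δ : ℕ}

theorem lambdaStar_pos (hΔ : 2 ≤ Δ) : 0 < lambdaStar Δ := by
  have : (0 : ℝ) < Δ - 1 := by
    rw [sub_pos]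
    exact_mod_cast hΔ
  unfold lambdaStar
  positivity

theorem one_sub_inv_inv_eq_div (hΔ : 2 ≤ Δ) : (1 - (Δ : ℝ)⁻¹)⁻¹ = Δ / (Δ - 1) := by
  have : (Δ : ℝ) ≠ 0 := by positivity
  rw [← inv_div, sub_div, div_self this, one_div]

theorem one_sub_inv_inv_le_two (hΔ : 2 ≤ Δ) : (1 - (Δ : ℝ)⁻¹)⁻¹ ≤ 2 := by
  have h2 : (2 : ℝ) ≤ Δ := by exact_mod_cast hΔ
  rw [one_sub_inv_inv_eq_div hΔ, div_le_iff₀ (by linarith)]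
  linarith

theorem lambdaStar_mul_pow_sub_one (hΔ : 2 ≤ Δ) :
    lambdaStar Δ * (1 - (Δ : ℝ)⁻¹)⁻¹ ^ (Δ - 1) = (Δ : ℝ)⁻¹ := by
  obtain ⟨k, rfl⟩ : ∃ k, Δ = k + 1 := ⟨Δ - 1, by omega⟩
  have hk : (k : ℝ) ≠ 0 := by
    have : k ≠ 0 := by omega
    exact_mod_cast this
  rw [one_sub_inv_inv_eq_div hΔ, lambdaStar, div_pow]
  push_cast
  simp only [add_sub_cancel_right]
  field_simp
  ring

theorem lambdaStar_mul_pow (hΔ : 2 ≤ Δ) :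
    lambdaStar Δ * (1 - (Δ : ℝ)⁻¹)⁻¹ ^ Δ = ((Δ : ℝ) - 1)⁻¹ := by
  have : (Δ : ℝ) ≠ 0 := by positivity
  rw [← pow_sub_one_mul (by omega : Δ ≠ 0), ← mul_assoc, lambdaStar_mul_pow_sub_one hΔ,
    one_sub_inv_inv_eq_div hΔ]
  field_simp

theorem lambdaStar_le_inv (hΔ : 2 ≤ Δ) : lambdaStar Δ ≤ (Δ : ℝ)⁻¹ := by
  have hA : 1 ≤ (1 - (Δ : ℝ)⁻¹)⁻¹ := by
    have : (2 : ℝ) ≤ Δ := by exact_mod_cast hΔ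
    rw [one_sub_inv_inv_eq_div hΔ, one_le_div₀ (by linarith)]
    linarith
  rw [← lambdaStar_mul_pow_sub_one hΔ]
  exact le_mul_of_one_le_right (lambdaStar_pos hΔ).le (one_le_pow₀ hA)

end Threshold

/-- The hypotheses of the contraction argument: `L` lists the neighbours of each vertex of a graph
of maximum degree at most `Δ`, and `lam` lies in the disc of radius `c * lambdaStar Δ`, where
`c < 1`. -/
structure Subcritical {V 𝕜 : Type*} [Fintype V] [DecidableEq V] [NormedField 𝕜]
    (G : SimpleGraph V) [DecidableRel G.Adj] (L : V → List V) (Δ : ℕ) (lam : 𝕜) (c : ℝ) :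
    Prop where
  toFinset_eq : ∀ v, (L v).toFinset = G.neighborFinset v
  degree_le : ∀ v, G.degree v ≤ Δ
  two_le : 2 ≤ Δ
  norm_le : ‖lam‖ ≤ c * lambdaStar Δ
  lt_one : c < 1

namespace Subcritical

variable {V 𝕜 : Type*} [Fintype V] [DecidableEq V] [NormedField 𝕜] {G : SimpleGraph V}
  [DecidableRel G.Adj] {L : V → List V} {Δ : ℕ} {lam : 𝕜} {c : ℝ} {X Y : Finset V → V → 𝕜}
  {S : Finset V} {v : V}

theorem nonneg (h : Subcritical G L Δ lam c) : 0 ≤ c :=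
  nonneg_of_mul_nonneg_left ((norm_nonneg lam).trans h.norm_le) (lambdaStar_pos h.two_le)

theorem inv_lt_one (h : Subcritical G L Δ lam c) : (Δ : ℝ)⁻¹ < 1 :=
  inv_lt_one_of_one_lt₀ (by exact_mod_cast h.two_le)

theorem ssubset_and_notMem_and_exists_adj (h : Subcritical G L Δ lam c) (hv : v ∉ S)
    {p : Finset V × V} (hp : p ∈ removals (insert v S) (L v)) :
    S ⊂ p.1 ∧ p.2 ∉ p.1 ∧ ∃ u ∈ p.1, G.Adj p.2 u := by
  obtain ⟨hsub, hmem, hL⟩ := subset_notMem_mem_of_mem_removals hp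
  refine ⟨(Finset.ssubset_insert hv).trans_subset hsub, hmem, v,
    hsub (Finset.mem_insert_self v S), ?_⟩
  rw [← List.mem_toFinset, h.toFinset_eq, SimpleGraph.mem_neighborFinset] at hL
  exact hL.symm

theorem length_removals_le (h : Subcritical G L Δ lam c) :
    (removals (insert v S) (L v)).length ≤ Δ := by
  rw [length_removals, h.toFinset_eq]
  exact (Finset.card_le_card Finset.sdiff_subset).trans (h.degree_le v)

theorem length_removals_le_of_adj (h : Subcritical G L Δ lam c) (hS : ∃ u ∈ S, G.Adj v u) :
    (removals (insert v S) (L v)).length ≤ Δ - 1 := by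
  obtain ⟨u, hu, hvu⟩ := hS
  have hlt : (G.neighborFinset v \ insert v S).card < G.degree v :=
    Finset.card_lt_card <| Finset.ssubset_iff_of_subset Finset.sdiff_subset |>.2
      ⟨u, by simpa using hvu, by simp [hu]⟩
  rw [length_removals, h.toFinset_eq]
  have := h.degree_le v
  omega

theorem norm_ratioStep_le (h : Subcritical G L Δ lam c)
    (hX : ∀ p ∈ removals (insert v S) (L v), ‖X p.1 p.2‖ ≤ (Δ : ℝ)⁻¹) :
    ‖ratioStep lam L X S v‖ ≤ c := by
  have hc := h.nonneg
  have hΔ : (2 : ℝ) ≤ Δ := by exact_mod_cast h.two_le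
  have hA := inv_pos.2 (sub_pos.2 h.inv_lt_one)
  calc ‖ratioStep lam L X S v‖
      ≤ ‖lam‖ * (1 - (Δ : ℝ)⁻¹)⁻¹ ^ Δ :=
        _root_.norm_ratioStep_le (by positivity) h.inv_lt_one h.length_removals_le hX
    _ ≤ c * lambdaStar Δ * (1 - (Δ : ℝ)⁻¹)⁻¹ ^ Δ := by
        gcongr
        exact h.norm_le
    _ = c * ((Δ : ℝ) - 1)⁻¹ := by rw [mul_assoc, lambdaStar_mul_pow h.two_le]
    _ ≤ c := mul_le_of_le_one_right hc (inv_le_one_of_one_le₀ (by linarith))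

theorem norm_ratioStep_le_of_adj (h : Subcritical G L Δ lam c) (hS : ∃ u ∈ S, G.Adj v u)
    (hX : ∀ p ∈ removals (insert v S) (L v), ‖X p.1 p.2‖ ≤ (Δ : ℝ)⁻¹) :
    ‖ratioStep lam L X S v‖ ≤ (Δ : ℝ)⁻¹ := by
  have hA := inv_pos.2 (sub_pos.2 h.inv_lt_one)
  calc ‖ratioStep lam L X S v‖
      ≤ ‖lam‖ * (1 - (Δ : ℝ)⁻¹)⁻¹ ^ (Δ - 1) :=
        _root_.norm_ratioStep_le (by positivity) h.inv_lt_one (h.length_removals_le_of_adj hS) hX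
    _ ≤ c * lambdaStar Δ * (1 - (Δ : ℝ)⁻¹)⁻¹ ^ (Δ - 1) := by
        gcongr
        exact h.norm_le
    _ = c * (Δ : ℝ)⁻¹ := by rw [mul_assoc, lambdaStar_mul_pow_sub_one h.two_le]
    _ ≤ (Δ : ℝ)⁻¹ := mul_le_of_le_one_left (by positivity) h.lt_one.le

theorem norm_ratioStep_sub_le (h : Subcritical G L Δ lam c) {δ : ℝ} (hδ : 0 ≤ δ)
    (hX : ∀ p ∈ removals (insert v S) (L v), ‖X p.1 p.2‖ ≤ (Δ : ℝ)⁻¹)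
    (hY : ∀ p ∈ removals (insert v S) (L v), ‖Y p.1 p.2‖ ≤ (Δ : ℝ)⁻¹)
    (hXY : ∀ p ∈ removals (insert v S) (L v), ‖X p.1 p.2 - Y p.1 p.2‖ ≤ δ) :
    ‖ratioStep lam L X S v - ratioStep lam L Y S v‖ ≤ 4 * (c * δ) := by
  set A := (1 - (Δ : ℝ)⁻¹)⁻¹
  have hc := h.nonneg
  have hA := inv_pos.2 (sub_pos.2 h.inv_lt_one)
  have hA2 : A ≤ 2 := one_sub_inv_inv_le_two h.two_le
  calc ‖ratioStep lam L X S v - ratioStep lam L Y S v‖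
      ≤ ‖lam‖ * (Δ * A ^ (Δ + 1) * δ) :=
        _root_.norm_ratioStep_sub_le (by positivity) h.inv_lt_one hδ h.length_removals_le hX hY hXY
    _ ≤ c * lambdaStar Δ * (Δ * A ^ (Δ + 1) * δ) := by
        gcongr
        exact h.norm_le
    _ = lambdaStar Δ * A ^ Δ * (Δ * A) * (c * δ) := by ring
    _ = A * A * (c * δ) := by
        rw [lambdaStar_mul_pow h.two_le, ← mul_assoc ((Δ : ℝ) - 1)⁻¹, inv_mul_eq_div,
          ← one_sub_inv_inv_eq_div h.two_le]
    _ ≤ 2 * 2 * (c * δ) := by gcongr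
    _ = 4 * (c * δ) := by ring

theorem norm_ratioStep_sub_le_of_adj (h : Subcritical G L Δ lam c) {δ : ℝ} (hδ : 0 ≤ δ)
    (hS : ∃ u ∈ S, G.Adj v u)
    (hX : ∀ p ∈ removals (insert v S) (L v), ‖X p.1 p.2‖ ≤ (Δ : ℝ)⁻¹)
    (hY : ∀ p ∈ removals (insert v S) (L v), ‖Y p.1 p.2‖ ≤ (Δ : ℝ)⁻¹)
    (hXY : ∀ p ∈ removals (insert v S) (L v), ‖X p.1 p.2 - Y p.1 p.2‖ ≤ δ) :
    ‖ratioStep lam L X S v - ratioStep lam L Y S v‖ ≤ c * δ := by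
  set A := (1 - (Δ : ℝ)⁻¹)⁻¹
  have hA := inv_pos.2 (sub_pos.2 h.inv_lt_one)
  have hΔ : (2 : ℝ) ≤ Δ := by exact_mod_cast h.two_le
  have hpred : ((Δ - 1 : ℕ) : ℝ) = Δ - 1 := by
    rw [Nat.cast_sub (by linarith [h.two_le]), Nat.cast_one]
  calc ‖ratioStep lam L X S v - ratioStep lam L Y S v‖
      ≤ ‖lam‖ * ((Δ - 1 : ℕ) * A ^ (Δ - 1 + 1) * δ) :=
        _root_.norm_ratioStep_sub_le (by positivity) h.inv_lt_one hδ
          (h.length_removals_le_of_adj hS) hX hY hXY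
    _ ≤ c * lambdaStar Δ * ((Δ - 1 : ℕ) * A ^ (Δ - 1 + 1) * δ) := by
        gcongr
        exact h.norm_le
    _ = lambdaStar Δ * A ^ Δ * (Δ - 1) * (c * δ) := by
        rw [Nat.sub_add_cancel (by linarith [h.two_le]), hpred]
        ring
    _ = c * δ := by
        rw [lambdaStar_mul_pow h.two_le, inv_mul_cancel₀ (by linarith), one_mul]

theorem norm_lam_le (h : Subcritical G L Δ lam c) : ‖lam‖ ≤ (Δ : ℝ)⁻¹ :=
  h.norm_le.trans <| (mul_le_of_le_one_left (lambdaStar_pos h.two_le).le h.lt_one.le).trans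
    (lambdaStar_le_inv h.two_le)

theorem norm_truncRatio_le_of_adj (h : Subcritical G L Δ lam c) (d : ℕ) (hv : v ∉ S)
    (hS : ∃ u ∈ S, G.Adj v u) : ‖truncRatio lam L d S v‖ ≤ (Δ : ℝ)⁻¹ := by
  induction d generalizing S v with
  | zero => exact h.norm_lam_le
  | succ d ih =>
    refine h.norm_ratioStep_le_of_adj hS fun p hp => ?_
    obtain ⟨-, hmem, hadj⟩ := h.ssubset_and_notMem_and_exists_adj hv hp
    exact ih hmem hadj

theorem hardcoreSum_ne_zero_and_norm_hardcoreRatio_le (h : Subcritical G L Δ lam c)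
    (S : Finset V) : hardcoreSum G lam S ≠ 0 ∧ ∀ v ∉ S, ‖hardcoreRatio G lam S v‖ ≤ c ∧
      ((∃ u ∈ S, G.Adj v u) → ‖hardcoreRatio G lam S v‖ ≤ (Δ : ℝ)⁻¹) := by
  induction S using WellFoundedGT.induction with
  | ind S ih =>
    have hratio : ∀ v ∉ S, ‖hardcoreRatio G lam S v‖ ≤ c ∧
        ((∃ u ∈ S, G.Adj v u) → ‖hardcoreRatio G lam S v‖ ≤ (Δ : ℝ)⁻¹) := by
      intro v hv
      have hchild : ∀ p ∈ removals (insert v S) (L v),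
          ‖hardcoreRatio G lam p.1 p.2‖ ≤ (Δ : ℝ)⁻¹ := fun p hp => by
        obtain ⟨hsub, hmem, hadj⟩ := h.ssubset_and_notMem_and_exists_adj hv hp
        exact ((ih p.1 hsub).2 p.2 hmem).2 hadj
      rw [hardcoreRatio_eq_ratioStep G (h.toFinset_eq v) fun T hT =>
        (ih T ((Finset.ssubset_insert hv).trans_subset hT)).1]
      exact ⟨h.norm_ratioStep_le hchild, fun hS => h.norm_ratioStep_le_of_adj hS hchild⟩
    refine ⟨?_, hratio⟩
    by_cases hS : S = Finset.univ
    · rw [hS, hardcoreSum_univ]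
      exact one_ne_zero
    · obtain ⟨v, hv⟩ := not_forall.1 (mt Finset.eq_univ_iff_forall.2 hS)
      have hinsert := (ih (insert v S) (Finset.ssubset_insert hv)).1
      rw [hardcoreSum_eq_one_add_mul G hv hinsert]
      exact mul_ne_zero (one_add_ne_zero_of_norm_le h.lt_one (hratio v hv).1) hinsert

theorem hardcoreSum_ne_zero (h : Subcritical G L Δ lam c) (S : Finset V) :
    hardcoreSum G lam S ≠ 0 :=
  (h.hardcoreSum_ne_zero_and_norm_hardcoreRatio_le S).1

theorem hardcoreRatio_eq (h : Subcritical G L Δ lam c) (S : Finset V) (v : V) :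
    hardcoreRatio G lam S v = ratioStep lam L (hardcoreRatio G lam) S v :=
  hardcoreRatio_eq_ratioStep G (h.toFinset_eq v) fun T _ => h.hardcoreSum_ne_zero T

theorem norm_hardcoreRatio_le (h : Subcritical G L Δ lam c) (hv : v ∉ S) :
    ‖hardcoreRatio G lam S v‖ ≤ c :=
  ((h.hardcoreSum_ne_zero_and_norm_hardcoreRatio_le S).2 v hv).1

theorem norm_hardcoreRatio_le_of_adj (h : Subcritical G L Δ lam c) (hv : v ∉ S)
    (hS : ∃ u ∈ S, G.Adj v u) : ‖hardcoreRatio G lam S v‖ ≤ (Δ : ℝ)⁻¹ :=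
  ((h.hardcoreSum_ne_zero_and_norm_hardcoreRatio_le S).2 v hv).2 hS

theorem norm_truncRatio_sub_le_of_adj (h : Subcritical G L Δ lam c) (d : ℕ) (hv : v ∉ S)
    (hS : ∃ u ∈ S, G.Adj v u) : ‖truncRatio lam L d S v - hardcoreRatio G lam S v‖ ≤ c ^ d := by
  induction d generalizing S v with
  | zero =>
    have hinv : (Δ : ℝ)⁻¹ ≤ 2⁻¹ := inv_anti₀ two_pos (by exact_mod_cast h.two_le)
    have hlam : ‖truncRatio lam L 0 S v‖ ≤ (Δ : ℝ)⁻¹ := h.norm_lam_le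
    rw [pow_zero]
    linarith [norm_sub_le (truncRatio lam L 0 S v) (hardcoreRatio G lam S v),
      h.norm_hardcoreRatio_le_of_adj hv hS]
  | succ d ih =>
    have hchild p (hp : p ∈ removals (insert v S) (L v)) :=
      (h.ssubset_and_notMem_and_exists_adj hv hp).2
    rw [h.hardcoreRatio_eq, pow_succ']
    exact h.norm_ratioStep_sub_le_of_adj (pow_nonneg h.nonneg d) hS
      (fun p hp => h.norm_truncRatio_le_of_adj d (hchild p hp).1 (hchild p hp).2)
      (fun p hp => h.norm_hardcoreRatio_le_of_adj (hchild p hp).1 (hchild p hp).2)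
      (fun p hp => ih (hchild p hp).1 (hchild p hp).2)

theorem norm_truncRatio_sub_le (h : Subcritical G L Δ lam c) (d : ℕ) (hv : v ∉ S) :
    ‖truncRatio lam L d S v - hardcoreRatio G lam S v‖ ≤ 4 * c ^ d := by
  cases d with
  | zero =>
    have hlam : ‖truncRatio lam L 0 S v‖ ≤ (Δ : ℝ)⁻¹ := h.norm_lam_le
    rw [pow_zero]
    linarith [norm_sub_le (truncRatio lam L 0 S v) (hardcoreRatio G lam S v),
      h.norm_hardcoreRatio_le hv, h.lt_one, h.inv_lt_one]
  | succ d =>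
    have hchild p (hp : p ∈ removals (insert v S) (L v)) :=
      (h.ssubset_and_notMem_and_exists_adj hv hp).2
    rw [h.hardcoreRatio_eq, pow_succ']
    exact h.norm_ratioStep_sub_le (pow_nonneg h.nonneg d)
      (fun p hp => h.norm_truncRatio_le_of_adj d (hchild p hp).1 (hchild p hp).2)
      (fun p hp => h.norm_hardcoreRatio_le_of_adj (hchild p hp).1 (hchild p hp).2)
      (fun p hp => h.norm_truncRatio_sub_le_of_adj d (hchild p hp).1 (hchild p hp).2)

end Subcritical

theorem isMultApprox_of_eq_mul_exp {ε : ℝ} {q ξ z : ℂ} (hq : q ≠ 0) (h : ξ = q * Complex.exp z)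
    (hz : ‖z‖ ≤ min ε 1) : IsMultApprox ε q ξ := by
  have hξ : ξ ≠ 0 := h ▸ mul_ne_zero hq (Complex.exp_ne_zero z)
  have hquot : q / ξ = Complex.exp (-z) := by
    rw [h, Complex.exp_neg, div_mul_cancel_left₀ hq]
  have hre := abs_le.1 ((Complex.abs_re_le_norm z).trans (hz.trans (min_le_left ε 1)))
  have him := (Complex.abs_im_le_norm z).trans hz
  refine ⟨hq, hξ, ?_, ?_, ?_⟩
  · rw [← norm_div, hquot, Complex.norm_exp, Complex.neg_re]
    exact Real.exp_le_exp.2 (neg_le_neg hre.2)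
  · rw [← norm_div, hquot, Complex.norm_exp, Complex.neg_re]
    exact Real.exp_le_exp.2 (neg_le.1 hre.1)
  · have hone := abs_le.1 (him.trans (min_le_right ε 1))
    have hpi := Real.pi_gt_three
    rw [InnerProductGeometry.angle_comm, Complex.angle_eq_abs_arg hq hξ, hquot,
      ← Complex.log_im, Complex.log_exp, Complex.neg_im, abs_neg]
    · exact him.trans (min_le_left ε 1)
    · rw [Complex.neg_im]
      linarith
    · rw [Complex.neg_im]
      linarith

theorem Subcritical.isMultApprox {V : Type*} [Fintype V] [DecidableEq V] {G : SimpleGraph V}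
    [DecidableRel G.Adj] {L : V → List V} {Δ : ℕ} {lam : ℂ} {c ε : ℝ} {l : List V} {d : ℕ}
    (h : Subcritical G L Δ lam c) (hl : ∀ v, v ∈ l)
    (hd : 8 * (l.length + 1) * c ^ d ≤ (1 - c) * min ε 1) :
    IsMultApprox ε (G.independencePolynomial.eval lam) (prodAlong (truncRatio lam L d) ∅ l) := by
  have hc : 0 < 1 - c := sub_pos.2 h.lt_one
  have hcd : 0 ≤ c ^ d := pow_nonneg h.nonneg d
  have hlen : ((removals ∅ l).length : ℝ) ≤ l.length := by
    rw [length_removals, Finset.sdiff_empty]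
    exact_mod_cast l.toFinset_card_le
  have hnew p (hp : p ∈ removals ∅ l) := (subset_notMem_mem_of_mem_removals hp).2.1
  have hsmall : 4 * c ^ d / (1 - c) ≤ 1 / 2 := by
    rw [div_le_iff₀ hc]
    nlinarith [min_le_right ε 1, mul_nonneg (Nat.cast_nonneg (α := ℝ) l.length) hcd]
  obtain ⟨z, hz, hnorm⟩ := exists_prod_one_add_eq_mul_exp h.lt_one
    (fun p hp => h.norm_hardcoreRatio_le (hnew p hp))
    (fun p hp => h.norm_truncRatio_sub_le d (hnew p hp)) hsmall
  have huniv : ∅ ∪ l.toFinset = Finset.univ := by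
    ext v
    simp [hl v]
  have hsum : hardcoreSum G lam ∅ = prodAlong (hardcoreRatio G lam) ∅ l := by
    rw [hardcoreSum_eq_prodAlong G fun p _ => h.hardcoreSum_ne_zero _, huniv, hardcoreSum_univ,
      mul_one]
  rw [← hardcoreSum_empty]
  refine isMultApprox_of_eq_mul_exp (h.hardcoreSum_ne_zero ∅) (hsum ▸ hz) (hnorm.trans ?_)
  calc (removals ∅ l).length * (3 / 2 * (4 * c ^ d / (1 - c)))
      ≤ l.length * (3 / 2 * (4 * c ^ d / (1 - c))) := by gcongr
    _ = 6 * l.length * c ^ d / (1 - c) := by ring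
    _ ≤ min ε 1 := by
        rw [div_le_iff₀ hc, mul_comm (min ε 1)]
        refine le_trans ?_ hd
        gcongr <;> linarith

/-! ### Depth-first evaluation of the truncated recursion -/

/-- The state of the evaluation of one product of the recursion: the number `fuel` of levels of the
recursion left below it, the vertices `removed` so far, the vertices `todo` still to be removed and
the value `val` of the product of the factors found so far. -/
structure Frame (V 𝕜 : Type*) where
  fuel : ℕ
  removed : Finset V
  todo : List V
  val : 𝕜

section Stack

variable {V 𝕜 : Type*} [DecidableEq V] [Field 𝕜]

/-- One step of the depth-first evaluation on a stack of frames. A new vertex opens a frame for the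
product in the denominator of its ratio, and a frame that is finished is closed by multiplying the
factor of its vertex into the frame below it. -/
def stackStep (lam : 𝕜) (L : V → List V) : List (Frame V 𝕜) → List (Frame V 𝕜)
  | ⟨d, S, w :: l, z⟩ :: K =>
    if w ∈ S then ⟨d, S, l, z⟩ :: K
    else ⟨d - 1, insert w S, if d = 0 then [] else L w, 1⟩ :: ⟨d, insert w S, l, z⟩ :: K
  | ⟨_, _, [], z⟩ :: F :: K => { F with val := F.val * (1 + lam / z) } :: K
  | stack => stack

variable {lam : 𝕜} {L : V → List V}

theorem exists_iterate_stackStep_of_vertex {d C : ℕ} (hC : 1 ≤ C)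
    (hvertex : ∀ S w l z K, w ∉ S → ∃ k ≤ C, (stackStep lam L)^[k] (⟨d, S, w :: l, z⟩ :: K) =
      ⟨d, insert w S, l, z * (1 + truncRatio lam L d S w)⟩ :: K)
    (S : Finset V) (l : List V) (z : 𝕜) (K : List (Frame V 𝕜)) :
    ∃ k ≤ l.length * C, (stackStep lam L)^[k] (⟨d, S, l, z⟩ :: K) =
      ⟨d, S ∪ l.toFinset, [], z * prodAlong (truncRatio lam L d) S l⟩ :: K := by
  induction l generalizing S z with
  | nil => exact ⟨0, by simp⟩
  | cons w l ih =>
    obtain ⟨j, hj, hhead⟩ : ∃ j ≤ C, (stackStep lam L)^[j] (⟨d, S, w :: l, z⟩ :: K) =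
        ⟨d, insert w S, l, if w ∈ S then z else z * (1 + truncRatio lam L d S w)⟩ :: K := by
      by_cases hw : w ∈ S
      · exact ⟨1, hC, by simp [stackStep, hw, Finset.insert_eq_of_mem hw]⟩
      · simpa [hw] using hvertex S w l z K hw
    obtain ⟨k, hk, htail⟩ := ih (insert w S) (if w ∈ S then z else _)
    refine ⟨k + j, by rw [List.length_cons, Nat.succ_mul]; omega, ?_⟩
    rw [Function.iterate_add_apply, hhead, htail, List.toFinset_cons, Finset.union_insert,
      Finset.insert_union]
    by_cases hw : w ∈ S
    · rw [prodAlong_cons_of_mem _ hw, Finset.insert_eq_of_mem hw, if_pos hw]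
    · rw [prodAlong_cons_of_notMem _ hw, if_neg hw, mul_assoc]

theorem exists_iterate_stackStep {Δ : ℕ} (hL : ∀ v, (L v).length ≤ Δ) (d : ℕ) (S : Finset V)
    (l : List V) (z : 𝕜) (K : List (Frame V 𝕜)) :
    ∃ k ≤ l.length * (2 * (Δ + 1) ^ d), (stackStep lam L)^[k] (⟨d, S, l, z⟩ :: K) =
      ⟨d, S ∪ l.toFinset, [], z * prodAlong (truncRatio lam L d) S l⟩ :: K := by
  induction d generalizing S l z K with
  | zero =>
    refine exists_iterate_stackStep_of_vertex (by simp)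
      (fun S w l z K hw => ⟨2, by simp, ?_⟩) S l z K
    simp [stackStep, hw, truncRatio]
  | succ d ih =>
    have hpow : 1 ≤ (Δ + 1) ^ d := Nat.one_le_pow _ _ (by omega)
    refine exists_iterate_stackStep_of_vertex (Nat.mul_pos two_pos (by positivity))
      (fun S w l z K hw => ?_) S l z K
    obtain ⟨k, hk, hchild⟩ := ih (insert w S) (L w) 1 (⟨d + 1, insert w S, l, z⟩ :: K)
    have hcost : (L w).length * (2 * (Δ + 1) ^ d) ≤ Δ * (2 * (Δ + 1) ^ d) :=
      Nat.mul_le_mul_right _ (hL w)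
    refine ⟨1 + (k + 1), by rw [pow_succ]; linarith, ?_⟩
    have hopen : (stackStep lam L)^[1] (⟨d + 1, S, w :: l, z⟩ :: K) =
        ⟨d, insert w S, L w, 1⟩ :: ⟨d + 1, insert w S, l, z⟩ :: K := by
      simp [stackStep, hw]
    rw [Function.iterate_add_apply, Function.iterate_add_apply, hopen, hchild, one_mul]
    rfl

end Stack

namespace RealRAM

/-! ### Reasoning about programs -/

/-- A Hoare triple with a time bound: started on `s`, the program `p` halts after at most `T` steps
with a memory that satisfies `Q`. -/
def Ensures (p : Program) (T : ℕ) (s : Store) (Q : Store → Prop) : Prop :=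
  ∃ s' t, t ≤ T ∧ Exec p s s' t ∧ Q s'

/-- A straight-line program. -/
def block : List Instr → Program
  | [] => .skip
  | i :: l => .seq (.instr i) (block l)

section Rules

variable {p q : Program} {c : Test} {s : Store} {Q R : Store → Prop} {T T' : ℕ}

theorem Ensures.mono (h : Ensures p T s Q) (hT : T ≤ T') (hQ : ∀ s', Q s' → R s') :
    Ensures p T' s R := by
  obtain ⟨s', t, ht, hexec, hs'⟩ := h
  exact ⟨s', t, ht.trans hT, hexec, hQ s' hs'⟩

theorem Ensures.seq (hp : Ensures p T s Q) (hq : ∀ s', Q s' → Ensures q T' s' R) :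
    Ensures (.seq p q) (T + T') s R := by
  obtain ⟨s₁, t₁, ht₁, hexec₁, h₁⟩ := hp
  obtain ⟨s₂, t₂, ht₂, hexec₂, h₂⟩ := hq s₁ h₁
  exact ⟨s₂, t₁ + t₂, by omega, .seq hexec₁ hexec₂, h₂⟩

theorem Ensures.ite (hp : c.Holds s → Ensures p T s Q) (hq : ¬ c.Holds s → Ensures q T s Q) :
    Ensures (.ite c p q) (T + 1) s Q := by
  by_cases hc : c.Holds s
  · obtain ⟨s', t, ht, hexec, hs'⟩ := hp hc
    exact ⟨s', t + 1, by omega, .iteTrue hc hexec, hs'⟩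
  · obtain ⟨s', t, ht, hexec, hs'⟩ := hq hc
    exact ⟨s', t + 1, by omega, .iteFalse hc hexec, hs'⟩

theorem ensures_block {l : List Instr} (h : Q (l.foldl Instr.run s)) :
    Ensures (block l) l.length s Q := by
  induction l generalizing s with
  | nil => exact ⟨s, 0, le_rfl, .skip s, h⟩
  | cons i l ih =>
    obtain ⟨s', t, ht, hexec, hs'⟩ := ih h
    exact ⟨s', 1 + t, by rw [List.length_cons]; omega, .seq (.instr i s) hexec, hs'⟩

theorem ensures_while {I : ℕ → Store → Prop} {k : ℕ} (h0 : I 0 s)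
    (hbody : ∀ j < k, ∀ s, I j s → c.Holds s → Ensures p T s (I (j + 1)))
    (hend : ∀ s, I k s → ¬ c.Holds s) :
    Ensures (.while c p) (k * (T + 1) + 1) s fun s' => ∃ j ≤ k, I j s' ∧ ¬ c.Holds s' := by
  induction k generalizing s I with
  | zero => exact ⟨s, 1, by omega, .whileFalse (hend s h0), 0, le_rfl, h0, hend s h0⟩
  | succ k ih =>
    by_cases hc : c.Holds s
    · obtain ⟨s₁, t₁, ht₁, hexec₁, h₁⟩ := hbody 0 k.succ_pos s h0 hc
      obtain ⟨s₂, t₂, ht₂, hexec₂, j, hj, h₂, hc₂⟩ :=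
        ih (I := fun j => I (j + 1)) h₁ (fun j hj => hbody (j + 1) (by omega)) hend
      exact ⟨s₂, t₁ + t₂ + 1, by rw [Nat.succ_mul]; omega, .whileTrue hc hexec₁ hexec₂,
        j + 1, by omega, h₂, hc₂⟩
    · exact ⟨s, 1, by omega, .whileFalse hc, 0, by omega, h0, hc⟩

end Rules

/-! ### The evaluation on the machine -/

namespace NatReg

abbrev size : ℕ := 0
abbrev height : ℕ := 1
abbrev one : ℕ := 2
abbrev fuel : ℕ := 3
abbrev pos : ℕ := 4
abbrev fin : ℕ := 5
abbrev vertex : ℕ := 6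
abbrev owner : ℕ := 7
abbrev version : ℕ := 8
abbrev stamp : ℕ := 9
abbrev work : ℕ := 10

end NatReg

/-! The arrays `pos`, `fin`, `fuel` and `version` are indexed by the level of a frame on the stack,
the arrays `owner` and `stamp` by a vertex. -/

namespace NatArr

abbrev start : ℕ := 0
abbrev adj : ℕ := 1
abbrev pos : ℕ := 2
abbrev fin : ℕ := 3
abbrev fuel : ℕ := 4
abbrev owner : ℕ := 5
abbrev stamp : ℕ := 6
abbrev version : ℕ := 7

end NatArr

namespace RealReg

abbrev eps : ℕ := 0
abbrev lamRe : ℕ := 1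
abbrev lamIm : ℕ := 2
abbrev valRe : ℕ := 3
abbrev valIm : ℕ := 4
abbrev factorRe : ℕ := 5
abbrev factorIm : ℕ := 6
abbrev scratch : ℕ := 7
abbrev sum : ℕ := 8

end RealReg

namespace RealArr

abbrev valRe : ℕ := 0
abbrev valIm : ℕ := 1

end RealArr

open Instr

/-- Loads the unread part of the list of the top frame and computes the number of steps that are at
least left: one for each frame but the root and one for each unread entry of the top frame. -/
def fetchTop : List Instr :=
  [natLoad NatReg.pos NatArr.pos NatReg.height, natLoad NatReg.fin NatArr.fin NatReg.height,
    natSub NatReg.work NatReg.fin NatReg.pos, natAdd NatReg.work NatReg.work NatReg.height]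

/-- Consumes the next vertex of the list of the top frame and loads its mark. -/
def readVertex : List Instr :=
  [natLoad NatReg.vertex NatArr.adj NatReg.pos, natAdd NatReg.pos NatReg.pos NatReg.one,
    natStore NatArr.pos NatReg.height NatReg.pos, natLoad NatReg.owner NatArr.owner NatReg.vertex,
    natLoad NatReg.version NatArr.version NatReg.owner,
    natLoad NatReg.stamp NatArr.stamp NatReg.vertex]

/-- Marks the vertex as removed and pushes the frame for the product below its ratio. -/
def openFrame : List Instr :=
  [natStore NatArr.owner NatReg.vertex NatReg.height,
    natLoad NatReg.version NatArr.version NatReg.height,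
    natAdd NatReg.stamp NatReg.version NatReg.one, natStore NatArr.stamp NatReg.vertex NatReg.stamp,
    natLoad NatReg.fuel NatArr.fuel NatReg.height,
    -- `1 - (1 - fuel)` is `min fuel 1`: without fuel the list of the new frame ends where it begins
    natSub NatReg.work NatReg.one NatReg.fuel, natSub NatReg.work NatReg.one NatReg.work,
    natSub NatReg.fuel NatReg.fuel NatReg.one, natAdd NatReg.height NatReg.height NatReg.one,
    natStore NatArr.fuel NatReg.height NatReg.fuel, natLoad NatReg.pos NatArr.start NatReg.vertex,
    natStore NatArr.pos NatReg.height NatReg.pos, natAdd NatReg.vertex NatReg.vertex NatReg.work,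
    natLoad NatReg.fin NatArr.start NatReg.vertex, natStore NatArr.fin NatReg.height NatReg.fin,
    realConst RealReg.valRe 1, realStore RealArr.valRe NatReg.height RealReg.valRe,
    realConst RealReg.valIm 0, realStore RealArr.valIm NatReg.height RealReg.valIm]

/-- Reads the value `z` of the top frame, computes `1 + lam / z` and pops the frame. -/
def popFactor : List Instr :=
  [realLoad RealReg.valRe RealArr.valRe NatReg.height,
    realLoad RealReg.valIm RealArr.valIm NatReg.height,
    realMul RealReg.sum RealReg.valRe RealReg.valRe,
    realMul RealReg.scratch RealReg.valIm RealReg.valIm,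
    realAdd RealReg.sum RealReg.sum RealReg.scratch,
    realMul RealReg.factorRe RealReg.lamRe RealReg.valRe,
    realMul RealReg.scratch RealReg.lamIm RealReg.valIm,
    realAdd RealReg.factorRe RealReg.factorRe RealReg.scratch,
    realDiv RealReg.factorRe RealReg.factorRe RealReg.sum, realConst RealReg.scratch 1,
    realAdd RealReg.factorRe RealReg.factorRe RealReg.scratch,
    realMul RealReg.factorIm RealReg.lamIm RealReg.valRe,
    realMul RealReg.scratch RealReg.lamRe RealReg.valIm,
    realSub RealReg.factorIm RealReg.factorIm RealReg.scratch,
    realDiv RealReg.factorIm RealReg.factorIm RealReg.sum,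
    natLoad NatReg.version NatArr.version NatReg.height,
    natAdd NatReg.version NatReg.version NatReg.one,
    natStore NatArr.version NatReg.height NatReg.version,
    natSub NatReg.height NatReg.height NatReg.one]

def multiplyFactor : List Instr :=
  [realLoad RealReg.valRe RealArr.valRe NatReg.height,
    realLoad RealReg.valIm RealArr.valIm NatReg.height,
    realMul RealReg.sum RealReg.valRe RealReg.factorRe,
    realMul RealReg.scratch RealReg.valIm RealReg.factorIm,
    realSub RealReg.sum RealReg.sum RealReg.scratch,
    realStore RealArr.valRe NatReg.height RealReg.sum,
    realMul RealReg.sum RealReg.valRe RealReg.factorIm,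
    realMul RealReg.scratch RealReg.valIm RealReg.factorRe,
    realAdd RealReg.sum RealReg.sum RealReg.scratch,
    realStore RealArr.valIm NatReg.height RealReg.sum]

/-- Carries out `stackStep` on the stack in memory. -/
def evalStep : Program :=
  .seq
    (.ite (.natLt NatReg.pos NatReg.fin)
      (.seq (block readVertex)
        (.ite (.natLt NatReg.version NatReg.stamp) .skip (block openFrame)))
      (block (popFactor ++ multiplyFactor)))
    (block fetchTop)

attribute [local simp] Instr.run Store.setNat Store.setReal Store.setNatArr Store.setRealArr

section Representation

variable {n : ℕ}

/-- The frame at the given level of the stack is stored in the memory. A vertex is removed for this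
frame if its owner, the level from which it was removed last, is not above the frame, and its stamp
is newer than the version of its owner, the number of frames closed at that level so far. -/
structure FrameAt (s : Store) (level : ℕ) (F : Frame (Fin n) ℂ) : Prop where
  fuel : s.natArr NatArr.fuel level = F.fuel
  todo : (List.Ico (s.natArr NatArr.pos level) (s.natArr NatArr.fin level)).map
    (s.natArr NatArr.adj) = F.todo.map Fin.val
  mem_removed_iff : ∀ u : Fin n, u ∈ F.removed ↔ s.natArr NatArr.owner u ≤ level ∧
    s.natArr NatArr.version (s.natArr NatArr.owner u) < s.natArr NatArr.stamp u
  val : F.val = ⟨s.realArr RealArr.valRe level, s.realArr RealArr.valIm level⟩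

/-- The memory holds the given stack, with the root at level `1`, and the data that stay fixed
during the evaluation. The last two conditions keep up the marks of the removed vertices when a
frame is closed. -/
structure Represents (lam : ℂ) (L : Fin n → List (Fin n)) (stack : List (Frame (Fin n) ℂ))
    (s : Store) : Prop where
  one : s.natReg NatReg.one = 1
  lam_eq : lam = ⟨s.realReg RealReg.lamRe, s.realReg RealReg.lamIm⟩
  adjacency : ∀ v : Fin n,
    (List.Ico (s.natArr NatArr.start v) (s.natArr NatArr.start (v + 1))).map
      (s.natArr NatArr.adj) = (L v).map Fin.val
  height : s.natReg NatReg.height = stack.length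
  frameAt : ∀ F K, F :: K <:+ stack → FrameAt s (F :: K).length F
  stamp_le : ∀ u : Fin n,
    s.natArr NatArr.stamp u ≤ s.natArr NatArr.version (s.natArr NatArr.owner u) + 1
  stamp_le_of_lt : ∀ u : Fin n, stack.length < s.natArr NatArr.owner u →
    s.natArr NatArr.stamp u ≤ s.natArr NatArr.version (s.natArr NatArr.owner u)

variable {lam : ℂ} {L : Fin n → List (Fin n)} {K : List (Frame (Fin n) ℂ)} {s : Store}

theorem Represents.congr {stack : List (Frame (Fin n) ℂ)} {s' : Store}
    (h : Represents lam L stack s) (hone : s'.natReg NatReg.one = s.natReg NatReg.one)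
    (hheight : s'.natReg NatReg.height = s.natReg NatReg.height)
    (hre : s'.realReg RealReg.lamRe = s.realReg RealReg.lamRe)
    (him : s'.realReg RealReg.lamIm = s.realReg RealReg.lamIm)
    (hnat : s'.natArr = s.natArr) (hreal : s'.realArr = s.realArr) :
    Represents lam L stack s' where
  one := hone ▸ h.one
  lam_eq := by rw [hre, him, h.lam_eq]
  adjacency := hnat ▸ h.adjacency
  height := hheight ▸ h.height
  frameAt F K hF := by
    obtain ⟨hfuel, htodo, hremoved, hval⟩ := h.frameAt F K hF
    constructor <;> simpa only [hnat, hreal]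
  stamp_le := hnat ▸ h.stamp_le
  stamp_le_of_lt := hnat ▸ h.stamp_le_of_lt

theorem Represents.frameAt_height {F : Frame (Fin n) ℂ} (h : Represents lam L (F :: K) s) :
    FrameAt s (s.natReg NatReg.height) F := by
  rw [h.height]
  exact h.frameAt F K List.suffix_rfl

theorem Represents.frameAt_of_suffix {F F' : Frame (Fin n) ℂ} {K' : List (Frame (Fin n) ℂ)}
    (h : Represents lam L (F :: K) s) (hK : F' :: K' <:+ K) : FrameAt s (F' :: K').length F' :=
  h.frameAt F' K' (hK.trans (List.suffix_cons F K))

theorem Represents.length_lt_height {F : Frame (Fin n) ℂ} {K' : List (Frame (Fin n) ℂ)}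
    (h : Represents lam L (F :: K) s) (hK : K' <:+ K) : K'.length < s.natReg NatReg.height := by
  rw [h.height, List.length_cons]
  exact Nat.lt_succ_of_le hK.length_le

theorem FrameAt.todo_eq_nil_iff {level : ℕ} {F : Frame (Fin n) ℂ} (h : FrameAt s level F) :
    F.todo = [] ↔ s.natArr NatArr.fin level ≤ s.natArr NatArr.pos level := by
  have hlen := congrArg List.length h.todo
  rw [List.length_map, List.length_map, List.Ico.length] at hlen
  rw [← List.length_eq_zero_iff, ← hlen, Nat.sub_eq_zero_iff_le]

theorem Represents.foldl_readVertex {d : ℕ} {S : Finset (Fin n)} {w : Fin n} {l : List (Fin n)}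
    {z : ℂ}
    (h : Represents lam L (⟨d, S, w :: l, z⟩ :: K) s)
    (hpos : s.natReg NatReg.pos = s.natArr NatArr.pos (s.natReg NatReg.height)) :
    Represents lam L (⟨d, S, l, z⟩ :: K) (readVertex.foldl Instr.run s) ∧
      (readVertex.foldl Instr.run s).natReg NatReg.vertex = w ∧
      (w ∈ S ↔ (Test.natLt NatReg.version NatReg.stamp).Holds (readVertex.foldl Instr.run s)) := by
  have htop := h.frameAt_height
  have hlt : s.natArr NatArr.pos (s.natReg NatReg.height) <
      s.natArr NatArr.fin (s.natReg NatReg.height) :=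
    not_le.1 fun hle => List.cons_ne_nil w l (htop.todo_eq_nil_iff.2 hle)
  have htodo := htop.todo
  rw [List.Ico.eq_cons hlt, List.map_cons, List.map_cons, List.cons.injEq] at htodo
  obtain ⟨hw, hl⟩ := htodo
  refine ⟨?_, by simp [readVertex, hpos, hw], ?_⟩
  · constructor
    case frameAt =>
      intro F' K' hF
      rcases List.suffix_cons_iff.1 hF with heq | hK
      · obtain ⟨rfl, rfl⟩ := List.cons.inj heq
        rw [List.length_cons, ← List.length_cons (a := ⟨d, S, w :: l, z⟩), ← h.height]
        constructor
        · simpa [readVertex] using htop.fuel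
        · simpa [readVertex, hpos, h.one] using hl
        · simpa [readVertex] using htop.mem_removed_iff
        · simpa [readVertex] using htop.val
      · have hlevel := (h.length_lt_height hK).ne
        obtain ⟨hfuel, htodo, hremoved, hval⟩ := h.frameAt_of_suffix hK
        generalize (F' :: K').length = level at *
        constructor <;> simpa [readVertex, Function.update_of_ne hlevel]
    · simpa [readVertex] using h.one
    · simpa [readVertex] using h.lam_eq
    · simpa [readVertex] using h.adjacency
    · simpa [readVertex] using h.height
    · simpa [readVertex] using h.stamp_le
    · simpa [readVertex] using h.stamp_le_of_lt
  · have hheight : s.natArr NatArr.version (s.natArr NatArr.owner w) < s.natArr NatArr.stamp w →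
        s.natArr NatArr.owner w ≤ s.natReg NatReg.height := fun hver => by
      rw [h.height]
      exact not_lt.1 fun howner => (h.stamp_le_of_lt w howner).not_gt hver
    rw [htop.mem_removed_iff]
    simpa [readVertex, Test.Holds, hpos, hw] using hheight

section OpenFrame

variable {level d : ℕ} {S : Finset (Fin n)} {w : Fin n} {l : List (Fin n)} {z : ℂ}

theorem FrameAt.foldl_openFrame_below {F : Frame (Fin n) ℂ} (h : FrameAt s level F)
    (htop : FrameAt s (s.natReg NatReg.height) ⟨d, S, l, z⟩)
    (hlevel : level < s.natReg NatReg.height) (hw : w ∉ S)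
    (hvertex : s.natReg NatReg.vertex = w) : FrameAt (openFrame.foldl Instr.run s) level F := by
  have hlevel' : level ≠ s.natReg NatReg.height + s.natReg NatReg.one := by omega
  constructor
  · simpa [openFrame, Function.update_of_ne hlevel'] using h.fuel
  · simpa [openFrame, Function.update_of_ne hlevel'] using h.todo
  · intro u
    rw [h.mem_removed_iff]
    by_cases hu : u = w
    · rw [← hu, htop.mem_removed_iff] at hw
      have hnot : ¬ (s.natArr NatArr.owner u ≤ level ∧
          s.natArr NatArr.version (s.natArr NatArr.owner u) < s.natArr NatArr.stamp u) :=
        fun hu => hw ⟨hu.1.trans hlevel.le, hu.2⟩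
      simpa [openFrame, hvertex, hu, hlevel.not_ge] using hnot
    · simp [openFrame, hvertex, Function.update_of_ne (Fin.val_injective.ne hu)]
  · simpa [openFrame, Function.update_of_ne hlevel'] using h.val

theorem FrameAt.foldl_openFrame_top (h : FrameAt s (s.natReg NatReg.height) ⟨d, S, l, z⟩)
    (hone : s.natReg NatReg.one = 1) (hvertex : s.natReg NatReg.vertex = w) :
    FrameAt (openFrame.foldl Instr.run s) (s.natReg NatReg.height) ⟨d, insert w S, l, z⟩ := by
  constructor
  · simpa [openFrame, hone] using h.fuel
  · simpa [openFrame, hone] using h.todo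
  · intro u
    rw [Finset.mem_insert, h.mem_removed_iff]
    by_cases hu : u = w
    · simp [openFrame, hvertex, hu, hone]
    · simp [openFrame, hvertex, hu, Function.update_of_ne (Fin.val_injective.ne hu)]
  · simpa [openFrame, hone] using h.val

theorem Represents.foldl_openFrame_child (h : Represents lam L (⟨d, S, l, z⟩ :: K) s)
    (hvertex : s.natReg NatReg.vertex = w) :
    FrameAt (openFrame.foldl Instr.run s) (s.natReg NatReg.height + 1)
      ⟨d - 1, insert w S, if d = 0 then [] else L w, 1⟩ := by
  have htop := h.frameAt_height
  constructor
  · simp [openFrame, h.one, htop.fuel]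
  · rcases Nat.eq_zero_or_pos d with hd | hd
    · simp [openFrame, h.one, htop.fuel, hvertex, hd]
    · have hmin : 1 - (1 - d) = 1 := by omega
      simpa [openFrame, h.one, htop.fuel, hvertex, hd.ne', hmin] using h.adjacency w
  · intro u
    rw [Finset.mem_insert, htop.mem_removed_iff]
    by_cases hu : u = w
    · simp [openFrame, hvertex, hu, h.one]
    · have howner : s.natArr NatArr.version (s.natArr NatArr.owner u) < s.natArr NatArr.stamp u →
          s.natArr NatArr.owner u ≤ s.natReg NatReg.height := fun hver => by
        rw [h.height]
        exact not_lt.1 fun howner => (h.stamp_le_of_lt u howner).not_gt hver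
      have hiff : ∀ {a b : ℕ} {P : Prop}, (P → a ≤ b) → (a ≤ b ∧ P ↔ a ≤ b + 1 ∧ P) :=
        fun h => ⟨fun h' => ⟨h'.1.trans (Nat.le_succ _), h'.2⟩, fun h' => ⟨h h'.2, h'.2⟩⟩
      simpa [openFrame, hvertex, hu, Function.update_of_ne (Fin.val_injective.ne hu)]
        using hiff howner
  · apply Complex.ext <;> simp [openFrame, h.one]

theorem Represents.foldl_openFrame (h : Represents lam L (⟨d, S, l, z⟩ :: K) s) (hw : w ∉ S)
    (hvertex : s.natReg NatReg.vertex = w) :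
    Represents lam L
      (⟨d - 1, insert w S, if d = 0 then [] else L w, 1⟩ :: ⟨d, insert w S, l, z⟩ :: K)
      (openFrame.foldl Instr.run s) := by
  have htop := h.frameAt_height
  have hheight : s.natReg NatReg.height = K.length + 1 := h.height
  have hne : ∀ u : Fin n, u ≠ w → (u : ℕ) ≠ w := fun u hu => Fin.val_injective.ne hu
  constructor
  case frameAt =>
    intro F' K' hF
    rcases List.suffix_cons_iff.1 hF with heq | hF
    · obtain ⟨rfl, rfl⟩ := List.cons.inj heq
      rw [List.length_cons, List.length_cons, ← hheight]
      exact h.foldl_openFrame_child hvertex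
    rcases List.suffix_cons_iff.1 hF with heq | hK
    · obtain ⟨rfl, rfl⟩ := List.cons.inj heq
      rw [List.length_cons, ← hheight]
      exact htop.foldl_openFrame_top h.one hvertex
    · exact (h.frameAt_of_suffix hK).foldl_openFrame_below htop (h.length_lt_height hK) hw hvertex
  · simpa [openFrame] using h.one
  · simpa [openFrame] using h.lam_eq
  · simpa [openFrame] using h.adjacency
  · simp [openFrame, h.one, hheight]
  · intro u
    by_cases hu : u = w
    · simp [openFrame, hvertex, hu, h.one]
    · simpa [openFrame, hvertex, Function.update_of_ne (hne u hu)] using h.stamp_le u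
  · intro u howner
    by_cases hu : u = w
    · simp [openFrame, hvertex, hu, hheight] at howner
    · have hlt : K.length + 1 < s.natArr NatArr.owner u := by
        refine (Nat.lt_succ_self _).trans ?_
        simpa [openFrame, hvertex, Function.update_of_ne (hne u hu)] using howner
      simpa [openFrame, hvertex, Function.update_of_ne (hne u hu)]
        using h.stamp_le_of_lt u hlt

end OpenFrame

section CloseFrame

theorem one_add_div_eq_mk (lam z : ℂ) :
    1 + lam / z = ⟨(lam.re * z.re + lam.im * z.im) / (z.re * z.re + z.im * z.im) + 1,
      (lam.im * z.re - lam.re * z.im) / (z.re * z.re + z.im * z.im)⟩ := by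
  rw [← Complex.normSq_apply]
  apply Complex.ext <;> simp [Complex.div_re, Complex.div_im] <;> ring

variable {F : Frame (Fin n) ℂ} {d : ℕ} {S : Finset (Fin n)} {z : ℂ}

theorem Represents.foldl_popFactor (h : Represents lam L (⟨d, S, [], z⟩ :: K) s) :
    Represents lam L K (popFactor.foldl Instr.run s) ∧
      1 + lam / z = ⟨(popFactor.foldl Instr.run s).realReg RealReg.factorRe,
        (popFactor.foldl Instr.run s).realReg RealReg.factorIm⟩ := by
  have hheight : s.natReg NatReg.height = K.length + 1 := h.height
  constructor
  · constructor
    case frameAt =>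
      intro F' K' hK
      have hlevel := h.length_lt_height hK
      obtain ⟨hfuel, htodo, hremoved, hval⟩ := h.frameAt_of_suffix hK
      generalize (F' :: K').length = level at *
      constructor
      · simpa [popFactor]
      · simpa [popFactor]
      · intro u
        rw [hremoved u]
        refine and_congr_right fun howner => ?_
        simp [popFactor, Function.update_of_ne (howner.trans_lt hlevel).ne]
      · simpa [popFactor]
    · simpa [popFactor] using h.one
    · simpa [popFactor] using h.lam_eq
    · simpa [popFactor] using h.adjacency
    · simp [popFactor, h.one, hheight]
    · intro u
      have hstamp := h.stamp_le u
      by_cases hu : s.natArr NatArr.owner u = s.natReg NatReg.height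
      · simpa [popFactor, hu, h.one] using (hu ▸ hstamp).trans (Nat.le_succ _)
      · simpa [popFactor, Function.update_of_ne hu] using hstamp
    · intro u howner
      by_cases hu : s.natArr NatArr.owner u = s.natReg NatReg.height
      · simpa [popFactor, hu, h.one] using h.stamp_le u
      · have hlt : K.length + 1 < s.natArr NatArr.owner u :=
          lt_of_le_of_ne (by simpa [popFactor] using howner) (hheight ▸ Ne.symm hu)
        simpa [popFactor, Function.update_of_ne hu] using h.stamp_le_of_lt u hlt
  · rw [one_add_div_eq_mk, h.lam_eq, show z = _ from h.frameAt_height.val]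
    simp [popFactor]

theorem Represents.foldl_multiplyFactor (h : Represents lam L (F :: K) s) :
    Represents lam L ({ F with
      val := F.val * ⟨s.realReg RealReg.factorRe, s.realReg RealReg.factorIm⟩ } :: K)
      (multiplyFactor.foldl Instr.run s) := by
  have htop := h.frameAt_height
  have hheight : s.natReg NatReg.height = K.length + 1 := h.height
  constructor
  case frameAt =>
    intro F' K' hF
    rcases List.suffix_cons_iff.1 hF with heq | hK
    · obtain ⟨rfl, rfl⟩ := List.cons.inj heq
      rw [List.length_cons, ← hheight]
      constructor
      · simpa [multiplyFactor] using htop.fuel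
      · simpa [multiplyFactor] using htop.todo
      · simpa [multiplyFactor] using htop.mem_removed_iff
      · rw [htop.val]
        apply Complex.ext <;> simp [multiplyFactor]
    · have hlevel := (h.length_lt_height hK).ne
      obtain ⟨hfuel, htodo, hremoved, hval⟩ := h.frameAt_of_suffix hK
      generalize (F' :: K').length = level at *
      constructor <;> simpa [multiplyFactor, Function.update_of_ne hlevel]
  · simpa [multiplyFactor] using h.one
  · simpa [multiplyFactor] using h.lam_eq
  · simpa [multiplyFactor] using h.adjacency
  · simp [multiplyFactor, hheight]
  · simpa [multiplyFactor] using h.stamp_le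
  · simpa [multiplyFactor] using h.stamp_le_of_lt

end CloseFrame

end Representation

section EvaluationLoop

variable {n : ℕ} {lam : ℂ} {L : Fin n → List (Fin n)} {stack : List (Frame (Fin n) ℂ)} {s : Store}

/-- The memory at the test of the main loop: it holds the stack, and the registers set by `fetchTop`
are up to date. -/
structure Ready (lam : ℂ) (L : Fin n → List (Fin n)) (stack : List (Frame (Fin n) ℂ))
    (s : Store) : Prop extends Represents lam L stack s where
  ne_nil : stack ≠ []
  pos : s.natReg NatReg.pos = s.natArr NatArr.pos (s.natReg NatReg.height)
  fin : s.natReg NatReg.fin = s.natArr NatArr.fin (s.natReg NatReg.height)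
  work : s.natReg NatReg.work =
    s.natReg NatReg.fin - s.natReg NatReg.pos + s.natReg NatReg.height

theorem Represents.foldl_fetchTop (h : Represents lam L stack s) (hne : stack ≠ []) :
    Ready lam L stack (fetchTop.foldl Instr.run s) where
  toRepresents := by apply h.congr <;> simp [fetchTop]
  ne_nil := hne
  pos := by simp [fetchTop]
  fin := by simp [fetchTop]
  work := by simp [fetchTop]

theorem Ready.todo_eq_nil_iff {F : Frame (Fin n) ℂ} {K : List (Frame (Fin n) ℂ)}
    (h : Ready lam L (F :: K) s) : F.todo = [] ↔ ¬ (Test.natLt NatReg.pos NatReg.fin).Holds s := by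
  rw [h.frameAt_height.todo_eq_nil_iff, Test.Holds, h.pos, h.fin, not_lt]

theorem Ready.ensures_evalStep (h : Ready lam L stack s)
    (hwork : (Test.natLt NatReg.one NatReg.work).Holds s) :
    Ensures evalStep 34 s (Ready lam L (stackStep lam L stack)) := by
  obtain _ | ⟨⟨d, S, l, z⟩, K⟩ := stack
  · exact absurd rfl h.ne_nil
  suffices hstep : Ensures _ 30 s fun s' =>
      Represents lam L (stackStep lam L (⟨d, S, l, z⟩ :: K)) s' ∧
        stackStep lam L (⟨d, S, l, z⟩ :: K) ≠ [] from
    hstep.seq fun s' hs' => ensures_block (hs'.1.foldl_fetchTop hs'.2)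
  refine Ensures.ite (T := 29) (fun hlt => ?_) fun hlt => ?_
  · obtain _ | ⟨w, l⟩ := l
    · exact absurd hlt (h.todo_eq_nil_iff.1 rfl)
    have hblock : Ensures (block readVertex) 6 s fun s' =>
        Represents lam L (⟨d, S, l, z⟩ :: K) s' ∧ s'.natReg NatReg.vertex = w ∧
          (w ∈ S ↔ (Test.natLt NatReg.version NatReg.stamp).Holds s') :=
      ensures_block (h.foldl_readVertex h.pos)
    refine (hblock.seq fun s' hs' => Ensures.ite (T := 19) (fun hw => ?_) fun hw => ?_).mono
      (by decide) fun s' hs' => hs'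
    · obtain ⟨hread, -, hmem⟩ := hs'
      simp only [stackStep, hmem.2 hw, if_true]
      exact ⟨s', 0, Nat.zero_le _, .skip s', hread, List.cons_ne_nil _ _⟩
    · obtain ⟨hread, hvertex, hmem⟩ := hs'
      simp only [stackStep, mt hmem.1 hw, if_false]
      exact ensures_block ⟨hread.foldl_openFrame (mt hmem.1 hw) hvertex, List.cons_ne_nil _ _⟩
  · obtain rfl : l = [] := h.todo_eq_nil_iff.2 hlt
    obtain _ | ⟨F, K⟩ := K
    · simp_all [Test.Holds, h.work, h.one, h.height]
    · obtain ⟨hpop, hfactor⟩ := h.foldl_popFactor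
      refine ensures_block ⟨?_, List.cons_ne_nil _ _⟩
      simpa only [List.foldl_append, stackStep, hfactor] using hpop.foldl_multiplyFactor

theorem Ready.exists_singleton (h : Ready lam L stack s)
    (hwork : ¬ (Test.natLt NatReg.one NatReg.work).Holds s) : ∃ F, stack = [F] ∧ F.todo = [] := by
  obtain _ | ⟨F, K⟩ := stack
  · exact absurd rfl h.ne_nil
  have hlength : s.natReg NatReg.fin - s.natReg NatReg.pos + (K.length + 1) ≤ 1 := by
    rw [← List.length_cons (a := F), ← h.height, ← h.work, ← h.one]
    exact not_lt.1 hwork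
  obtain rfl : K = [] := List.length_eq_zero_iff.1 (by omega)
  refine ⟨F, rfl, h.todo_eq_nil_iff.2 fun hlt => ?_⟩
  rw [Test.Holds] at hlt
  omega

theorem Ready.ensures_while_evalStep {Δ d : ℕ} {S : Finset (Fin n)} {l : List (Fin n)} {z : ℂ}
    (h : Ready lam L [⟨d, S, l, z⟩] s) (hL : ∀ v, (L v).length ≤ Δ) :
    Ensures (.while (.natLt NatReg.one NatReg.work) evalStep)
      (l.length * (2 * (Δ + 1) ^ d) * 35 + 1) s
      (Ready lam L [⟨d, S ∪ l.toFinset, [], z * prodAlong (truncRatio lam L d) S l⟩]) := by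
  obtain ⟨k, hk, hfinal⟩ := exists_iterate_stackStep (lam := lam) hL d S l z []
  have hloop := ensures_while (k := k) (I := fun j =>
      Ready lam L ((stackStep lam L)^[j] [⟨d, S, l, z⟩])) h
    (fun j _ s hs hwork => by
      rw [Function.iterate_succ_apply']
      exact hs.ensures_evalStep hwork)
    fun s hs => by
      rw [hfinal] at hs
      have hfin := not_lt.1 (hs.todo_eq_nil_iff.1 rfl)
      simp [Test.Holds, hs.work, hs.one, hs.height, hfin]
  refine hloop.mono (by gcongr) fun s ⟨j, hj, hs, hwork⟩ => ?_
  obtain ⟨⟨d', S', _, z'⟩, hsingle, rfl⟩ := hs.exists_singleton hwork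
  have hfixed : (stackStep lam L)^[k - j] [⟨d', S', [], z'⟩] = [⟨d', S', [], z'⟩] :=
    Function.iterate_fixed rfl _
  rw [← hfinal, ← Nat.sub_add_cancel hj, Function.iterate_add_apply, hsingle, hfixed, ← hsingle]
  exact hs

end EvaluationLoop

section Input

variable {n : ℕ} (L : Fin n → List (Fin n))

theorem map_Ico_getD {α : Type*} (l : List α) (x : α) {a b : ℕ} (hb : b ≤ l.length) :
    (List.Ico a b).map (fun i => l.getD i x) = (l.take b).drop a := by
  refine List.ext_getElem (by simp [hb]) fun i hi _ => ?_
  rw [List.length_map, List.Ico.length] at hi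
  simp [List.Ico, show a + i < l.length by omega]

theorem startPos_mono {v w : ℕ} (h : v ≤ w) : startPos L v ≤ startPos L w :=
  Finset.sum_le_sum_of_subset (Finset.monotone_filter_right _ fun _ _ hu => hu.trans_le h)

theorem startPos_eq_sum_take (v : ℕ) :
    startPos L v = (((List.ofFn fun v => (L v).map Fin.val).map List.length).take v).sum := by
  simp [List.map_ofFn, List.sum_take_ofFn, startPos, Function.comp_def]

theorem startPos_le_length_entries (v : ℕ) : startPos L v ≤ (entries L).length := by
  rw [startPos_eq_sum_take, entries, List.length_flatten]
  exact List.Sublist.sum_le_sum (List.take_sublist _ _) (by simp)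

theorem map_Ico_startPos_getD_entries (v : Fin n) :
    (List.Ico (startPos L v) (startPos L (v + 1))).map (fun i => (entries L).getD i 0) =
      (L v).map Fin.val := by
  rw [map_Ico_getD _ _ (startPos_le_length_entries L _), startPos_eq_sum_take, startPos_eq_sum_take,
    entries, List.drop_take_succ_flatten_eq_getElem _ _ (by simp)]
  simp

end Input

/-- Makes the list of all vertices, appended to the adjacency lists, the list of the root. -/
def writeRoot : List Instr :=
  [natConst NatReg.one 1, natConst NatReg.height 1,
    natLoad NatReg.pos NatArr.start NatReg.size, natStore NatArr.pos NatReg.height NatReg.pos,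
    natAdd NatReg.fin NatReg.pos NatReg.size, natStore NatArr.fin NatReg.height NatReg.fin,
    realConst RealReg.valRe 1, realStore RealArr.valRe NatReg.height RealReg.valRe]

def listVertex : List Instr :=
  [natAdd NatReg.fin NatReg.pos NatReg.vertex, natStore NatArr.adj NatReg.fin NatReg.vertex,
    natAdd NatReg.vertex NatReg.vertex NatReg.one]

/-- Puts `c` into the register `factorRe` and the error bound `8 * (n + 1)` at depth `0` into the
register `sum`. -/
def initTolerance (c : ℚ) : List Instr :=
  [realConst RealReg.factorRe c, realOfNat RealReg.sum NatReg.size,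
    realConst RealReg.scratch 1, realAdd RealReg.sum RealReg.sum RealReg.scratch,
    realConst RealReg.factorIm 8, realMul RealReg.sum RealReg.factorIm RealReg.sum]

def clampTolerance : Program :=
  .ite (.realLt RealReg.scratch RealReg.eps) (.instr (realCopy RealReg.eps RealReg.scratch)) .skip

def scaleTolerance : List Instr :=
  [realSub RealReg.scratch RealReg.scratch RealReg.factorRe,
    realMul RealReg.eps RealReg.scratch RealReg.eps]

def deepen : List Instr :=
  [realMul RealReg.sum RealReg.sum RealReg.factorRe,
    natAdd NatReg.fuel NatReg.fuel NatReg.one, natStore NatArr.fuel NatReg.height NatReg.fuel]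

def writeOutput : List Instr :=
  [realLoad RealReg.eps RealArr.valRe NatReg.height,
    realLoad RealReg.lamRe RealArr.valIm NatReg.height]

def setRoot : Program :=
  .seq (block writeRoot) (.while (.natLt NatReg.vertex NatReg.size) (block listVertex))

/-- Gives the root the least fuel `d` with `8 * (n + 1) * c ^ d ≤ (1 - c) * min ε 1`. -/
def setFuel (c : ℚ) : Program :=
  .seq (block (initTolerance c))
    (.seq clampTolerance (.seq (block scaleTolerance)
      (.while (.realLt RealReg.eps RealReg.sum) (block deepen))))

def evaluate : Program :=
  .seq (block fetchTop) (.seq (.while (.natLt NatReg.one NatReg.work) evalStep) (block writeOutput))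

/-- Approximates the independence polynomial by the truncated recursion with contraction factor
`c`. -/
def approximate (c : ℚ) : Program :=
  .seq setRoot (.seq (setFuel c) evaluate)

section Root

/-- The memory `s'` arises from `s` by writing the vertices below `k` into the array of the
adjacency lists, behind the position `NatReg.pos`. -/
structure VerticesListed (s : Store) (k : ℕ) (s' : Store) : Prop where
  vertex : s'.natReg NatReg.vertex = k
  natReg : ∀ r, r ≠ NatReg.vertex → r ≠ NatReg.fin → s'.natReg r = s.natReg r
  realReg : s'.realReg = s.realReg
  natArr : ∀ A, A ≠ NatArr.adj → s'.natArr A = s.natArr A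
  realArr : s'.realArr = s.realArr
  adj_of_lt : ∀ i < s.natReg NatReg.pos, s'.natArr NatArr.adj i = s.natArr NatArr.adj i
  adj_add : ∀ i < k, s'.natArr NatArr.adj (s.natReg NatReg.pos + i) = i

variable {s s' : Store} {k : ℕ}

theorem VerticesListed.succ (h : VerticesListed s k s') (hone : s.natReg NatReg.one = 1) :
    VerticesListed s (k + 1) (listVertex.foldl Instr.run s') := by
  have hone' : s'.natReg NatReg.one = 1 := by rw [h.natReg _ (by decide) (by decide), hone]
  have hpos : s'.natReg NatReg.pos = s.natReg NatReg.pos := h.natReg _ (by decide) (by decide)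
  constructor
  · simp [listVertex, h.vertex, hone']
  · intro r hvertex hfin
    simp [listVertex, hvertex, hfin, h.natReg]
  · simp [listVertex, h.realReg]
  · intro A hA
    simp [listVertex, hA, h.natArr]
  · simp [listVertex, h.realArr]
  · intro i hi
    have hne : i ≠ s.natReg NatReg.pos + k := by omega
    simp [listVertex, h.vertex, hpos, hne, h.adj_of_lt i hi]
  · intro i hi
    rcases Nat.lt_succ_iff_lt_or_eq.1 hi with hi | rfl
    · simp [listVertex, h.vertex, hpos, hi.ne, h.adj_add i hi]
    · simp [listVertex, h.vertex, hpos]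

theorem ensures_verticesListed (hone : s.natReg NatReg.one = 1)
    (hvertex : s.natReg NatReg.vertex = 0) :
    Ensures (.while (.natLt NatReg.vertex NatReg.size) (block listVertex))
      (s.natReg NatReg.size * 4 + 1) s (VerticesListed s (s.natReg NatReg.size)) := by
  have hsize {k : ℕ} {s' : Store} (h : VerticesListed s k s') :
      s'.natReg NatReg.size = s.natReg NatReg.size := h.natReg _ (by decide) (by decide)
  have hloop := ensures_while (I := VerticesListed s) (k := s.natReg NatReg.size)
    ⟨hvertex, by simp, rfl, by simp, rfl, by simp, by simp⟩
    (fun k _ s' hs' _ => ensures_block (hs'.succ hone))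
    (c := .natLt NatReg.vertex NatReg.size) fun s' hs' => by
      rw [Test.Holds, hs'.vertex, hsize hs']
      exact lt_irrefl _
  refine hloop.mono le_rfl fun s' ⟨k, hk, hs', hexit⟩ => ?_
  rw [Test.Holds, hs'.vertex, hsize hs', not_lt] at hexit
  exact hk.antisymm hexit ▸ hs'

variable {n : ℕ} {L : Fin n → List (Fin n)} {ε : ℝ} {lam : ℂ}

theorem frameAt_of_verticesListed
    (h : VerticesListed (writeRoot.foldl Instr.run (input L ε lam)) n s) :
    FrameAt s 1 ⟨0, ∅, List.finRange n, 1⟩ := by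
  have hpos : (writeRoot.foldl Instr.run (input L ε lam)).natReg NatReg.pos = startPos L n := by
    simp [writeRoot, input]
  constructor
  · rw [h.natArr _ (by decide)]
    simp [writeRoot, input]
  · have hstart : s.natArr NatArr.pos 1 = startPos L n := by
      rw [h.natArr _ (by decide)]
      simp [writeRoot, input]
    have hend : s.natArr NatArr.fin 1 = startPos L n + n := by
      rw [h.natArr _ (by decide)]
      simp [writeRoot, input]
    rw [hstart, hend, List.Ico, Nat.add_sub_cancel_left, List.range'_eq_map_range, List.map_map,
      List.map_coe_finRange_eq_range]
    nth_rw 2 [← List.map_id (List.range n)]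
    exact List.map_congr_left fun i hi => hpos ▸ h.adj_add i (List.mem_range.1 hi)
  · intro u
    rw [h.natArr NatArr.owner (by decide), h.natArr NatArr.version (by decide),
      h.natArr NatArr.stamp (by decide)]
    simp [writeRoot, input]
  · rw [h.realArr]
    apply Complex.ext <;> simp [writeRoot, input]

theorem represents_of_verticesListed
    (h : VerticesListed (writeRoot.foldl Instr.run (input L ε lam)) n s) :
    Represents lam L [⟨0, ∅, List.finRange n, 1⟩] s := by
  have hpos : (writeRoot.foldl Instr.run (input L ε lam)).natReg NatReg.pos = startPos L n := by
    simp [writeRoot, input]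
  constructor
  case frameAt =>
    intro F K hF
    obtain ⟨rfl, rfl⟩ | hK := (List.suffix_cons_iff.1 hF).imp List.cons.inj id
    · exact frameAt_of_verticesListed h
    · exact absurd (List.suffix_nil.1 hK) (List.cons_ne_nil F K)
  · rw [h.natReg _ (by decide) (by decide)]
    simp [writeRoot]
  · rw [h.realReg]
    simp [writeRoot, input]
  · intro v
    have hstart : ∀ w ≤ n, s.natArr NatArr.start w = startPos L w := fun w hw => by
      rw [h.natArr _ (by decide)]
      simp [writeRoot, input, hw]
    rw [← map_Ico_startPos_getD_entries, hstart v v.2.le, hstart (v + 1) v.2]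
    refine List.map_congr_left fun i hi => ?_
    rw [h.adj_of_lt i (hpos ▸ (List.Ico.mem.1 hi).2.trans_le (startPos_mono L v.2))]
    simp [writeRoot, input]
  · rw [h.natReg _ (by decide) (by decide)]
    simp [writeRoot]
  · rw [h.natArr _ (by decide), h.natArr _ (by decide), h.natArr _ (by decide)]
    simp [writeRoot, input]
  · rw [h.natArr _ (by decide), h.natArr _ (by decide), h.natArr _ (by decide)]
    simp [writeRoot, input]

theorem ensures_setRoot (L : Fin n → List (Fin n)) (ε : ℝ) (lam : ℂ) :
    Ensures setRoot (8 + (n * 4 + 1)) (input L ε lam) fun s =>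
      Represents lam L [⟨0, ∅, List.finRange n, 1⟩] s ∧ s.natReg NatReg.fuel = 0 ∧
        s.natReg NatReg.size = n ∧ s.realReg RealReg.eps = ε := by
  have hblock : Ensures (block writeRoot) 8 (input L ε lam)
      (· = writeRoot.foldl Instr.run (input L ε lam)) := ensures_block rfl
  have hsize : (writeRoot.foldl Instr.run (input L ε lam)).natReg NatReg.size = n := by
    simp [writeRoot, input]
  refine hblock.seq fun s hs => hs ▸ ((ensures_verticesListed ?_ ?_).mono (by rw [hsize]) ?_)
  · simp [writeRoot]
  · simp [writeRoot, input]
  · intro s' hs'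
    rw [hsize] at hs'
    refine ⟨represents_of_verticesListed hs', ?_, ?_, ?_⟩
    · rw [hs'.natReg _ (by decide) (by decide)]
      simp [writeRoot, input]
    · rw [hs'.natReg _ (by decide) (by decide), hsize]
    · rw [hs'.realReg]
      simp [writeRoot, input]

end Root

section Fuel

variable {n d : ℕ} {L : Fin n → List (Fin n)} {lam : ℂ} {l : List (Fin n)} {c τ x ε : ℝ} {s : Store}

/-- The memory while the fuel `d` of the root is chosen: the register `RealReg.sum` holds the error
bound `x * c ^ d`, and the register `RealReg.eps` the tolerance `τ`. -/
structure Deepening (lam : ℂ) (L : Fin n → List (Fin n)) (l : List (Fin n)) (c x τ : ℝ) (d : ℕ)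
    (s : Store) : Prop extends Represents lam L [⟨d, ∅, l, 1⟩] s where
  fuel_eq : s.natReg NatReg.fuel = d
  factor : s.realReg RealReg.factorRe = c
  sum : s.realReg RealReg.sum = x * c ^ d
  eps : s.realReg RealReg.eps = τ

theorem Deepening.succ (h : Deepening lam L l c x τ d s) :
    Deepening lam L l c x τ (d + 1) (deepen.foldl Instr.run s) := by
  have hheight : s.natReg NatReg.height = 1 := h.height
  have hroot := hheight ▸ h.frameAt_height
  constructor
  · constructor
    case frameAt =>
      intro F K hF
      obtain ⟨rfl, rfl⟩ | hK := (List.suffix_cons_iff.1 hF).imp List.cons.inj id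
      · change FrameAt _ 1 _
        constructor
        · simp [deepen, hheight, h.fuel_eq, h.one]
        · simpa [deepen] using hroot.todo
        · simpa [deepen] using hroot.mem_removed_iff
        · simpa [deepen] using hroot.val
      · exact absurd (List.suffix_nil.1 hK) (List.cons_ne_nil F K)
    · simpa [deepen] using h.one
    · simpa [deepen] using h.lam_eq
    · simpa [deepen] using h.adjacency
    · simpa [deepen] using h.height
    · simpa [deepen] using h.stamp_le
    · simpa [deepen] using h.stamp_le_of_lt
  · simp [deepen, h.fuel_eq, h.one]
  · simp [deepen, h.factor]
  · simp [deepen, h.sum, h.factor, pow_succ, mul_assoc]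
  · simp [deepen, h.eps]

theorem Deepening.ensures_while_deepen {D : ℕ} (h : Deepening lam L l c x τ 0 s)
    (hD : x * c ^ D ≤ τ) :
    Ensures (.while (.realLt RealReg.eps RealReg.sum) (block deepen)) (D * 4 + 1) s fun s' =>
      ∃ d ≤ D, x * c ^ d ≤ τ ∧ Represents lam L [⟨d, ∅, l, 1⟩] s' := by
  have hexit {d s'} (hs' : Deepening lam L l c x τ d s') :
      ¬ (Test.realLt RealReg.eps RealReg.sum).Holds s' ↔ x * c ^ d ≤ τ := by
    rw [Test.Holds, hs'.eps, hs'.sum, not_lt]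
  refine (ensures_while h (fun d _ s' hs' _ => ensures_block hs'.succ)
    fun s' hs' => (hexit hs').2 hD).mono le_rfl fun s' ⟨d, hd, hs', htest⟩ => ?_
  exact ⟨d, hd, (hexit hs').1 htest, hs'.toRepresents⟩

theorem Deepening.ensures_clampTolerance (h : Deepening lam L l c x ε d s)
    (hscratch : s.realReg RealReg.scratch = 1) :
    Ensures clampTolerance 2 s fun s' =>
      s'.realReg RealReg.scratch = 1 ∧ Deepening lam L l c x (min ε 1) d s' := by
  refine Ensures.ite (fun hlt => ?_) fun hlt => ?_
  · rw [Test.Holds, h.eps, hscratch] at hlt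
    rw [min_eq_right hlt.le]
    refine ⟨_, 1, le_rfl, .instr _ s, by simp [hscratch], ?_, ?_, ?_, ?_, ?_⟩
    · apply h.congr <;> simp
    · simp [h.fuel_eq]
    · simp [h.factor]
    · simp [h.sum]
    · simp [hscratch]
  · rw [Test.Holds, h.eps, hscratch, not_lt] at hlt
    rw [min_eq_left hlt]
    exact ⟨s, 0, Nat.zero_le _, .skip s, hscratch, h⟩

theorem Deepening.foldl_scaleTolerance (h : Deepening lam L l c x τ d s)
    (hscratch : s.realReg RealReg.scratch = 1) :
    Deepening lam L l c x ((1 - c) * τ) d (scaleTolerance.foldl Instr.run s) := by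
  refine ⟨?_, ?_, ?_, ?_, ?_⟩
  · apply h.congr <;> simp [scaleTolerance]
  · simp [scaleTolerance, h.fuel_eq]
  · simp [scaleTolerance, h.factor]
  · simp [scaleTolerance, h.sum]
  · simp [scaleTolerance, hscratch, h.factor, h.eps]

theorem Represents.ensures_setFuel {c : ℚ} {D : ℕ} (h : Represents lam L [⟨0, ∅, l, 1⟩] s)
    (hfuel : s.natReg NatReg.fuel = 0) (hsize : s.natReg NatReg.size = n)
    (heps : s.realReg RealReg.eps = ε)
    (hD : 8 * ((n : ℝ) + 1) * c ^ D ≤ (1 - c) * min ε 1) :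
    Ensures (setFuel c) (6 + (2 + (2 + (D * 4 + 1)))) s fun s' =>
      ∃ d ≤ D, 8 * ((n : ℝ) + 1) * c ^ d ≤ (1 - c) * min ε 1 ∧
        Represents lam L [⟨d, ∅, l, 1⟩] s' := by
  have hinit : Ensures (block (initTolerance c)) 6 s fun s' => s'.realReg RealReg.scratch = 1 ∧
      Deepening lam L l c (8 * (n + 1)) ε 0 s' :=
    ensures_block ⟨by simp [initTolerance], by apply h.congr <;> simp [initTolerance],
      by simpa [initTolerance] using hfuel, by simp [initTolerance],
      by simp [initTolerance, hsize], by simp [initTolerance, heps]⟩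
  exact hinit.seq fun _ h₁ => (h₁.2.ensures_clampTolerance h₁.1).seq fun _ h₂ =>
    (ensures_block (h₂.2.foldl_scaleTolerance h₂.1)).seq fun _ h₃ => h₃.ensures_while_deepen hD

end Fuel

/-! ### The algorithm and its running time -/

section Algorithm

variable {n Δ D : ℕ} {G : SimpleGraph (Fin n)} [DecidableRel G.Adj] {L : Fin n → List (Fin n)}
  {lam : ℂ} {c : ℚ} {ε : ℝ}

theorem Represents.ensures_evaluate {d : ℕ} {l : List (Fin n)} {s : Store}
    (h : Represents lam L [⟨d, ∅, l, 1⟩] s) (hL : ∀ v, (L v).length ≤ Δ) :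
    Ensures evaluate (4 + (l.length * (2 * (Δ + 1) ^ d) * 35 + 1 + 2)) s fun s' =>
      output s' = prodAlong (truncRatio lam L d) ∅ l := by
  refine (ensures_block (h.foldl_fetchTop (List.cons_ne_nil _ _))).seq fun s₁ hs₁ =>
    (hs₁.ensures_while_evalStep hL).seq fun s₂ hs₂ => ensures_block ?_
  rw [← one_mul (prodAlong _ _ _)]
  refine Eq.trans ?_ hs₂.frameAt_height.val.symm
  simp [writeOutput, output]

theorem ensures_approximate (h : Subcritical G L Δ lam c) (hL : ∀ v, (L v).length ≤ Δ)
    (hD : 8 * ((n : ℝ) + 1) * c ^ D ≤ (1 - c) * min ε 1) :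
    Ensures (approximate c) (100 * (n + 1) * (Δ + 1) ^ D) (input L ε lam) fun s =>
      IsMultApprox ε (G.independencePolynomial.eval lam) (output s) := by
  have hΔ := h.two_le
  have htime : 8 + (n * 4 + 1) + (6 + (2 + (2 + (D * 4 + 1))) +
      (4 + (n * (2 * (Δ + 1) ^ D) * 35 + 1 + 2))) ≤ 100 * (n + 1) * (Δ + 1) ^ D := by
    have hpow : D + 1 ≤ (Δ + 1) ^ D := Nat.lt_pow_self (by omega)
    nlinarith [Nat.zero_le (n * D)]
  refine ((ensures_setRoot L ε lam).seq fun s₁ ⟨hs₁, hfuel, hsize, heps⟩ =>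
    (hs₁.ensures_setFuel hfuel hsize heps hD).seq fun s₂ ⟨d, hd, hacc, hs₂⟩ =>
      (hs₂.ensures_evaluate hL).mono ?_ fun s hs => hs ▸ ?_).mono htime fun s hs => hs
  · rw [List.length_finRange]
    gcongr
    omega
  · exact h.isMultApprox List.mem_finRange (by rwa [List.length_finRange])

theorem exists_pow_le_and_pow_le {c a : ℝ} (hc0 : 0 < c) (hc1 : c < 1) (ha : 0 ≤ a) :
    ∃ k : ℕ, ∀ x, 0 < x → x ≤ 1 → ∃ D : ℕ, c ^ D ≤ x ∧ a ^ D ≤ (c * x)⁻¹ ^ k := by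
  obtain ⟨k, hk⟩ := pow_unbounded_of_one_lt a (one_lt_inv₀ hc0 |>.2 hc1)
  refine ⟨k, fun x hx0 hx1 => ?_⟩
  obtain ⟨m, hlt, hle⟩ := exists_nat_pow_near_of_lt_one hx0 hx1 hc0 hc1
  refine ⟨m + 1, hlt.le, ?_⟩
  calc a ^ (m + 1) ≤ (c⁻¹ ^ k) ^ (m + 1) := by gcongr
    _ = (c * c ^ m)⁻¹ ^ k := by rw [pow_right_comm, inv_pow, pow_succ']
    _ ≤ (c * x)⁻¹ ^ k := by gcongr

theorem exists_mul_pow_le_natCast_mul_pow (B : ℝ) (k : ℕ) :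
    ∃ K : ℕ, ∀ y : ℝ, 1 ≤ y → B * y ^ k ≤ K * y ^ K := by
  refine ⟨max ⌈B⌉₊ k, fun y hy => ?_⟩
  gcongr
  · exact (Nat.le_ceil B).trans (by exact_mod_cast le_max_left _ k)
  · exact le_max_right _ k

theorem exists_ensures_approximate (Δ : ℕ) (hc0 : 0 < c) (hc1 : c < 1) :
    ∃ K : ℕ, ∀ (lam : ℂ) (n : ℕ) (G : SimpleGraph (Fin n)) [DecidableRel G.Adj]
      (L : Fin n → List (Fin n)), Subcritical G L Δ lam c → (∀ v, (L v).length ≤ Δ) →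
        ∀ ε : ℝ, 0 < ε → ∃ T : ℕ, (T : ℝ) ≤ K * (((n : ℝ) + 1) / min ε 1) ^ K ∧
          Ensures (approximate c) T (input L ε lam) fun s =>
            IsMultApprox ε (G.independencePolynomial.eval lam) (output s) := by
  have hc0' : (0 : ℝ) < c := by exact_mod_cast hc0
  have hc1' : (0 : ℝ) < 1 - c := by exact_mod_cast sub_pos.2 hc1
  obtain ⟨k, hk⟩ := exists_pow_le_and_pow_le hc0' (sub_pos.1 hc1') (a := Δ + 1) (by positivity)
  obtain ⟨K, hK⟩ :=
    exists_mul_pow_le_natCast_mul_pow (100 * (8 / (c * (1 - c))) ^ k : ℝ) (k + 1)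
  refine ⟨K, fun lam n G _ L h hL ε hε => ?_⟩
  set μ := min ε 1
  have hμ0 : 0 < μ := lt_min hε one_pos
  have hμ1 : μ ≤ 1 := min_le_right ε 1
  have hn : (1 : ℝ) ≤ n + 1 := by linarith [n.cast_nonneg (α := ℝ)]
  obtain ⟨D, hacc, hpow⟩ := hk ((1 - c) * μ / (8 * (n + 1))) (by positivity) (by
    rw [div_le_one (by positivity)]
    nlinarith)
  refine ⟨_, ?_, ensures_approximate h hL (D := D) ?_⟩
  · calc ((100 * (n + 1) * (Δ + 1) ^ D : ℕ) : ℝ)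
        = 100 * (n + 1) * (Δ + 1) ^ D := by push_cast; ring
      _ ≤ 100 * ((n + 1) / μ) * (c * ((1 - c) * μ / (8 * (n + 1))))⁻¹ ^ k := by
          gcongr
          exact le_div_self (by positivity) hμ0 hμ1
      _ = 100 * (8 / (c * (1 - c))) ^ k * ((n + 1) / μ) ^ (k + 1) := by
          rw [show (c * ((1 - c) * μ / (8 * (n + 1))) : ℝ)⁻¹ =
            8 / (c * (1 - c)) * ((n + 1) / μ) by field_simp, mul_pow]
          ring
      _ ≤ K * ((n + 1) / μ) ^ K := hK _ (hn.trans (le_div_self (by positivity) hμ0 hμ1))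
  · rwa [le_div_iff₀ (by positivity), mul_comm] at hacc

end Algorithm

end RealRAM

theorem theorem1p2_general (Δ : ℕ) (hΔ : 2 ≤ Δ) {r : ℝ} (hr : r < lambdaStar Δ) :
    ∃ (p : RealRAM.Program) (K : ℕ), ∀ lam : ℂ, ‖lam‖ ≤ r →
      ∀ (n : ℕ) (G : SimpleGraph (Fin n)) [DecidableRel G.Adj], G.maxDegree ≤ Δ →
        ∀ L : Fin n → List (Fin n), RealRAM.IsAdjacencyList G L →
          ∀ ε : ℝ, 0 < ε →
            ∃ (s : RealRAM.Store) (t : ℕ),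
              RealRAM.Exec p (RealRAM.input L ε lam) s t ∧
              (t : ℝ) ≤ K * (((n : ℝ) + 1) / min ε 1) ^ K ∧
              IsMultApprox ε (G.independencePolynomial.eval lam) (RealRAM.output s) := by
  have hpos := lambdaStar_pos hΔ
  obtain ⟨c, hc, hc1⟩ := exists_rat_btwn (max_lt ((div_lt_one hpos).2 hr) one_pos)
  obtain ⟨hrc, hc0⟩ := max_lt_iff.1 hc
  obtain ⟨K, hK⟩ := RealRAM.exists_ensures_approximate Δ (c := c) (by exact_mod_cast hc0)
    (by exact_mod_cast hc1)
  refine ⟨RealRAM.approximate c, K, fun lam hlam n G _ hG L hL ε hε => ?_⟩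
  have hneighbors v : (L v).toFinset = G.neighborFinset v := by
    ext w
    rw [List.mem_toFinset, G.mem_neighborFinset, (hL v).2]
  have hdegree v : G.degree v ≤ Δ := (G.degree_le_maxDegree v).trans hG
  have hlength v : (L v).length ≤ Δ := by
    rw [← List.toFinset_card_of_nodup (hL v).1, hneighbors]
    exact hdegree v
  have hsub : Subcritical G L Δ lam c :=
    ⟨hneighbors, hdegree, hΔ, hlam.trans ((div_lt_iff₀ hpos).1 hrc).le, hc1⟩
  obtain ⟨T, hT, s, t, ht, hexec, happrox⟩ := hK lam n G L hsub hlength ε hε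
  exact ⟨s, t, hexec, (Nat.cast_le.2 ht).trans hT, happrox⟩

theorem theorem1p2 (Δ : ℕ) (hΔ : 2 ≤ Δ) (lam : ℂ) (hlam : ‖lam‖ < lambdaStar Δ) :
    ∃ (p : RealRAM.Program) (K : ℕ),
      ∀ (n : ℕ) (G : SimpleGraph (Fin n)) [DecidableRel G.Adj], G.maxDegree ≤ Δ →
        ∀ L : Fin n → List (Fin n), RealRAM.IsAdjacencyList G L →
          ∀ ε : ℝ, 0 < ε →
            ∃ (s : RealRAM.Store) (t : ℕ),
              RealRAM.Exec p (RealRAM.input L ε lam) s t ∧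
              (t : ℝ) ≤ K * (((n : ℝ) + 1) / min ε 1) ^ K ∧
              IsMultApprox ε (G.independencePolynomial.eval lam) (RealRAM.output s) := by
  obtain ⟨p, K, h⟩ := theorem1p2_general Δ hΔ hlam
  exact ⟨p, K, h lam le_rfl⟩
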